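/- Let $n\ge 0$ and let $E^n\subset\mathbb{R}^{n+1}$ be the hyperplane of vectors with coordinate sum zero, with the Euclidean inner product inherited from $\mathbb{R}^{n+1}$ and the induced $n$-dimensional Euclidean volume $\mathrm{Vol}_n$ (a unit cube on an orthonormal basis of $E^n$ has volume $1$; for $n=0$ a point has volume $1$). Let $\alpha_i=\varepsilon_i-\varepsilon_{i+1}$ and let $\varpi_1,\dots,\varpi_n\in E^n$ be the fundamental weights, defined by $(\varpi_i,\alpha_j)=\delta_{ij}$. The symmetric group $\mathfrak{S}_{n+1}$ acts on $E^n$ by permuting coordinates, and for $\lambda\in E^n$ the permutohedron is $\mathsf{P}_n(\lambda)=\mathrm{Conv}(\mathfrak{S}_{n+1}\cdot\lambda)$. For $1\le i\le d$ put $$\Gamma'_{d,i}(x_1,x_2,\dots)=\frac{1}{d\sqrt{c_{d,i,i}}}\binom{d+1}{i}\sum_{j=1}^{d}c_{d,i,j}\,x_j,\qquad c_{d,i,j}=\min\{i,j\}-\frac{ij}{d+1},$$ where the $c_{d,i,j}$ are the entries of the inverse of the Cartan matrix of type $A_d$. For a polynomial $p$ and $u\ge0$ let $p[u](x_1,x_2,\dots)=p(x_{1+u},x_{2+u},\dots)$.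 An $n$-Dyck path is a lattice path from $(0,0)$ to $(n,n)$ with north steps $(0,1)$ and east steps $(1,0)$ that stays weakly above the diagonal $y=x$; let $\mathcal{D}_n$ be the set of all of them. For a north step $N$ of $D\in\mathcal{D}_n$ with initial point $(u,u')$, let $D_N$ be the part of $D$ from $(u,u')$ to $(n,n)$, translated by $-(u,u')$, and let $K$ be the (non-empty) set of integers $1\le k\le n-u$ such that $D_N$ passes through $(k,k)$ and its sub-path from $(0,0)$ to $(k,k)$ is a $k$-Dyck path. Put $\Gamma'_N=\Gamma'_{d,i}[u]$ with $d=\max K$ and $i=\min K$, and $\Gamma'_D=\prod_{N}\Gamma'_N$, the product over all north steps $N$ of $D$. Then for every $n\ge0$ there is a unique polynomial $\mathcal{V}_n\in\mathbb{R}[x_1,x_2,\dots]$ such that $$\mathcal{V}_n(x_1,x_2,\dots)=\mathrm{Vol}_n\bigl(\mathsf{P}_n(x_1\varpi_1+\cdots+x_n\varpi_n)\bigr)\quad\text{whenever } x_1,\dots,x_n\ge 0,$$ and $$\mathcal{V}_n=\sum_{D\in\mathcal{D}_n}\Gamma'_D .$$ -/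

import Mathlib

noncomputable section

namespace Permutohedron

/-! ### The root system of type `A_n` -/

/-- The Euclidean space `E`: the hyperplane of vectors of coordinate sum zero in `ℝ^(n+1)`,
with the inner product inherited from `ℝ^(n+1)`. -/
def E (n : ℕ) : Submodule ℝ (EuclideanSpace ℝ (Fin (n + 1))) where
  carrier := {v | ∑ k, v k = 0}
  zero_mem' := by simp
  add_mem' := by
    intro a b ha hb
    simp only [Set.mem_ofPred_eq, PiLp.add_apply, Finset.sum_add_distrib] at *
    rw [ha, hb, add_zero]
  smul_mem' := by
    intro c a ha
    simp only [Set.mem_ofPred_eq, PiLp.smul_apply, smul_eq_mul, ← Finset.mul_sum] at *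
    rw [ha, mul_zero]

/-- The simple root `α_{i+1} = ε_{i+1} - ε_{i+2}` (the index `i : Fin n` starts from `0`). -/
def simpleRoot (n : ℕ) (i : Fin n) : E n :=
  ⟨EuclideanSpace.single i.castSucc (1 : ℝ) - EuclideanSpace.single i.succ (1 : ℝ), by
    change ∑ k : Fin (n + 1), (EuclideanSpace.single i.castSucc (1 : ℝ) -
      EuclideanSpace.single i.succ (1 : ℝ)) k = 0
    simp⟩

/-- The fundamental weight `ϖ_{i+1}` (the index `i : Fin n` starts from `0`): the vector
`(1, …, 1, 0, …, 0) - (i+1)/(n+1) • (1, …, 1)` with `i + 1` leading ones. It is characterised in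
`eq_fundamentalWeight_iff` by `(ϖ_i, α_j) = δ_{ij}`. -/
def fundamentalWeight (n : ℕ) (i : Fin n) : E n :=
  ⟨WithLp.toLp 2 fun k : Fin (n + 1) =>
      (if (k : ℕ) ≤ i then 1 else 0) - ((i : ℝ) + 1) / ((n : ℝ) + 1), by
    have h : (Finset.univ.filter fun k : Fin (n + 1) => (k : ℕ) ≤ i) = Finset.Iic i.castSucc := by
      ext k; simp [Fin.le_def]
    have hn : (n : ℝ) + 1 ≠ 0 := by positivity
    change ∑ k : Fin (n + 1), ((if (k : ℕ) ≤ i then (1 : ℝ) else 0) - _) = 0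
    rw [Finset.sum_sub_distrib, Finset.sum_boole, h, Fin.card_Iic]
    simp
    field_simp
    ring⟩

theorem inner_simpleRoot (n : ℕ) (v : E n) (j : Fin n) :
    inner ℝ v (simpleRoot n j) = v.1 j.castSucc - v.1 j.succ := by
  simp [simpleRoot, Submodule.coe_inner, inner_sub_right, EuclideanSpace.inner_single_right]

/-- The fundamental weights are the vectors of `E` with `(ϖ_i, α_j) = δ_{ij}`. -/
theorem eq_fundamentalWeight_iff (n : ℕ) (i : Fin n) (v : E n) :
    v = fundamentalWeight n i ↔
      ∀ j, inner ℝ v (simpleRoot n j) = if i = j then (1 : ℝ) else 0 := by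
  have key : ∀ j, inner ℝ (fundamentalWeight n i) (simpleRoot n j)
      = if i = j then (1 : ℝ) else 0 := by
    intro j
    rw [inner_simpleRoot]
    simp only [fundamentalWeight, Fin.val_castSucc, Fin.val_succ, Fin.ext_iff]
    split_ifs <;> first | omega | simp
  refine ⟨fun h => h ▸ key, fun h => ?_⟩
  rw [← sub_eq_zero]
  set w := v - fundamentalWeight n i with hw
  have hroot : ∀ j : Fin n, w.1 j.castSucc = w.1 j.succ := by
    intro j
    have : inner ℝ w (simpleRoot n j) = (0 : ℝ) := by
      rw [hw, inner_sub_left, h, key, sub_self]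
    rw [inner_simpleRoot] at this
    linarith
  have hconst : ∀ k : Fin (n + 1), w.1 k = w.1 0 := by
    intro k
    induction k using Fin.induction with
    | zero => rfl
    | succ j ih => rw [← hroot, ih]
  have hsum : ∑ k, w.1 k = 0 := w.2
  rw [Finset.sum_congr rfl fun k _ => hconst k] at hsum
  have h0 : w.1 0 = 0 := by
    have hn : (n : ℝ) + 1 ≠ 0 := by positivity
    simpa [hn] using hsum
  ext k
  simp [hconst k, h0]

/-! ### The permutohedron and its volume -/

/-- The orbit of `v` under the Weyl group `S_{n+1}`, which permutes the coordinates. -/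
def weylOrbit (n : ℕ) (v : E n) : Set (E n) :=
  {w | ∃ σ : Equiv.Perm (Fin (n + 1)), ∀ k, w.1 k = v.1 (σ k)}

/-- The permutohedron `P_n(v) = Conv(S_{n+1} · v)`, a subset of `E`. -/
def permutohedron (n : ℕ) (v : E n) : Set (E n) :=
  convexHull ℝ (weylOrbit n v)

/-- The `n`-dimensional Euclidean volume on `E`: the translation invariant measure for which the
unit cube of an orthonormal basis of `E` has volume `1`. -/
def vol (n : ℕ) : MeasureTheory.Measure (E n) :=
  (stdOrthonormalBasis ℝ (E n)).toBasis.addHaar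

/-- `V` is the volume polynomial `𝒱_n`. We work in the polynomial ring `ℝ[x_1, x_2, …]`, with the
variable `x_{j+1}` written `MvPolynomial.X j`; the condition is
`V(x_1, x_2, …) = Vol_n(P_n(x_1 ϖ_1 + ⋯ + x_n ϖ_n))` for all `x_1, …, x_n ≥ 0`. -/
def IsVolumePolynomial (n : ℕ) (V : MvPolynomial ℕ ℝ) : Prop :=
  ∀ x : ℕ → ℝ, (∀ j < n, 0 ≤ x j) →
    MvPolynomial.eval x V =
      (vol n (permutohedron n (∑ i : Fin n, x i • fundamentalWeight n i))).toReal

/-! ### The `Γ`-polynomials -/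

/-- The coefficient `c_{d,i,j} = min{i,j} - ij/(d+1)`, for `1 ≤ i, j ≤ d`: the entry `(i,j)` of the
inverse of the Cartan matrix of type `A_d` (see `cartan_mul_cartanInv`). -/
def cartanInv (d i j : ℕ) : ℝ :=
  (min i j : ℕ) - (i * j : ℝ) / (d + 1)

theorem cartan_mul_cartanInv (d : ℕ) :
    (CartanMatrix.A d).map (Int.cast : ℤ → ℝ) *
      Matrix.of (fun i j : Fin d => cartanInv d (i + 1) (j + 1)) = 1 := by
  ext i k
  obtain ⟨i, hi⟩ := i
  obtain ⟨k, hk⟩ := k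
  have hd : (d : ℝ) + 1 ≠ 0 := by positivity
  have h0 : cartanInv d 0 (k + 1) = 0 := by simp [cartanInv]
  have h1 : cartanInv d (d + 1) (k + 1) = 0 := by
    simp only [cartanInv, Nat.min_eq_right (show k + 1 ≤ d + 1 by omega)]
    push_cast
    field_simp
    ring
  have hsum : ∑ j : Fin d, ((CartanMatrix.A d ⟨i, hi⟩ j : ℤ) : ℝ) * cartanInv d (j + 1) (k + 1) =
      2 * cartanInv d (i + 1) (k + 1) - cartanInv d i (k + 1) - cartanInv d (i + 2) (k + 1) := by
    have hA : ∀ j : Fin d, ((CartanMatrix.A d ⟨i, hi⟩ j : ℤ) : ℝ) * cartanInv d (j + 1) (k + 1) =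
        (if (j : ℕ) = i then 2 * cartanInv d (j + 1) (k + 1) else 0) -
        (if (j : ℕ) + 1 = i then cartanInv d (j + 1) (k + 1) else 0) -
        (if (j : ℕ) = i + 1 then cartanInv d (j + 1) (k + 1) else 0) := by
      intro j
      simp only [CartanMatrix.A, Matrix.of_apply, Fin.ext_iff]
      split_ifs <;> first | omega | simp
    rw [Finset.sum_congr rfl fun j _ => hA j, Finset.sum_sub_distrib, Finset.sum_sub_distrib]
    have e1 := Fin.sum_univ_eq_sum_range
      (fun j => if j = i then 2 * cartanInv d (j + 1) (k + 1) else 0) d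
    have e2 := Fin.sum_univ_eq_sum_range
      (fun j => if j + 1 = i then cartanInv d (j + 1) (k + 1) else 0) d
    have e3 := Fin.sum_univ_eq_sum_range
      (fun j => if j = i + 1 then cartanInv d (j + 1) (k + 1) else 0) d
    rw [e1, e2, e3]
    rw [Finset.sum_ite_eq', Finset.sum_ite_eq']
    have e4 : ∑ j ∈ Finset.range d, (if j + 1 = i then cartanInv d (j + 1) (k + 1) else 0) =
        cartanInv d i (k + 1) := by
      cases i with
      | zero => simp [h0]
      | succ i =>
        simp only [Nat.add_right_cancel_iff]
        rw [Finset.sum_ite_eq']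
        simp [show i < d by omega]
    rw [e4]
    simp only [Finset.mem_range, hi, if_true]
    split_ifs with h
    · rfl
    · have : i + 2 = d + 1 := by omega
      rw [this, h1]
  rw [Matrix.mul_apply]
  simp only [Matrix.map_apply, Matrix.of_apply]
  rw [hsum, Matrix.one_apply]
  simp only [Fin.mk.injEq, cartanInv]
  rcases lt_trichotomy i k with h | h | h
  · rw [if_neg h.ne, Nat.min_eq_left (by omega), Nat.min_eq_left (by omega),
      Nat.min_eq_left (by omega)]
    push_cast
    ring
  · subst h
    rw [if_pos rfl, Nat.min_eq_left (by omega), Nat.min_eq_left (by omega),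
      Nat.min_eq_right (by omega)]
    push_cast
    ring
  · rw [if_neg h.ne', Nat.min_eq_right (by omega), Nat.min_eq_right (by omega),
      Nat.min_eq_right (by omega)]
    push_cast
    ring

/-- The linear form
`Γ'_{d,i} = 1/(d √c_{d,i,i}) * binom(d+1, i) * ∑_{j=1}^d c_{d,i,j} x_j`, for `1 ≤ i ≤ d`
(recall that `MvPolynomial.X j` is the variable `x_{j+1}`). -/
def gamma (d i : ℕ) : MvPolynomial ℕ ℝ :=
  MvPolynomial.C (1 / (d * √(cartanInv d i i)) * ((d + 1).choose i : ℝ)) *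
    ∑ j ∈ Finset.range d, MvPolynomial.C (cartanInv d i (j + 1)) * MvPolynomial.X j

/-- The shift `p[u](x_1, x_2, …) = p(x_{1+u}, x_{2+u}, …)`. -/
def shift (u : ℕ) (p : MvPolynomial ℕ ℝ) : MvPolynomial ℕ ℝ :=
  MvPolynomial.rename (fun j => j + u) p

/-! ### Dyck paths

An `n`-Dyck path is a Mathlib Dyck word of semilength `n`: the letter `U` is a north step `(0,1)` and
the letter `D` an east step `(1,0)`. -/

/-- The set `𝒟_n` of `n`-Dyck paths. -/
abbrev DyckPath (n : ℕ) : Type := {D : DyckWord // D.semilength = n}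

/-- The positions `t` of the north steps in the list of steps of `D`. -/
def northSteps {n : ℕ} (D : DyckPath n) : Finset ℕ :=
  (Finset.range D.1.toList.length).filter fun t => D.1.toList[t]? = some DyckStep.U

/-- The first coordinate `u` of the initial point of the step of `D` at position `t`: the number
of east steps before it. -/
def startX {n : ℕ} (D : DyckPath n) (t : ℕ) : ℕ :=
  (D.1.toList.take t).count DyckStep.D

/-- The set `K` of all `k` with `1 ≤ k ≤ n - u` such that the part of `D` from the step at position
`t` on, translated to the origin, passes through `(k,k)` and is a `k`-Dyck path up to there. -/
def returns {n : ℕ} (D : DyckPath n) (t : ℕ) : Set ℕ :=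
  {k | 1 ≤ k ∧ k + startX D t ≤ n ∧
    ∃ Q : DyckPath k, Q.1.toList = (D.1.toList.drop t).take (2 * k)}

theorem bddAbove_returns {n : ℕ} (D : DyckPath n) (t : ℕ) : BddAbove (returns D t) :=
  ⟨n, fun _ hk => (Nat.le_add_right _ _).trans hk.2.1⟩

theorem returns_nonempty {n : ℕ} (D : DyckPath n) {t : ℕ} (ht : t ∈ northSteps D) :
    (returns D t).Nonempty := by
  obtain ⟨htl, htU⟩ := Finset.mem_filter.1 ht
  rw [Finset.mem_range] at htl
  set L := D.1.toList.drop t with hL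
  have hU := congrArg (List.count DyckStep.U) (List.take_append_drop t D.1.toList)
  have hD := congrArg (List.count DyckStep.D) (List.take_append_drop t D.1.toList)
  rw [List.count_append, ← hL] at hU hD
  have hpre := D.1.count_D_le_count_U t
  have htot := D.1.count_U_eq_count_D
  have hn : D.1.toList.count DyckStep.U = n := D.2
  have hL0 : L[0]? = some DyckStep.U := by rw [hL, List.getElem?_drop]; simpa using htU
  have hLlen : 1 ≤ L.length := by rw [hL, List.length_drop]; omega
  have hex : ∃ m, 1 ≤ m ∧ (L.take m).count DyckStep.U ≤ (L.take m).count DyckStep.D :=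
    ⟨L.length, hLlen, by rw [List.take_length]; omega⟩
  classical
  set m := Nat.find hex with hm
  obtain ⟨hm1, hmle⟩ := Nat.find_spec hex
  rw [← hm] at hm1 hmle
  have hmin : ∀ j < m, (L.take j).count DyckStep.D ≤ (L.take j).count DyckStep.U := by
    intro j hj
    rcases Nat.eq_zero_or_pos j with rfl | hj0
    · simp
    · have := Nat.find_min hex hj
      by_contra hcon
      exact this ⟨hj0, by omega⟩
  have hstep : (L.take m).count DyckStep.D ≤ (L.take (m - 1)).count DyckStep.D + 1 ∧
      (L.take (m - 1)).count DyckStep.U ≤ (L.take m).count DyckStep.U := by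
    have : m = (m - 1) + 1 := by omega
    rw [this, List.take_add_one, List.count_append, List.count_append]
    refine ⟨?_, by simp⟩
    rw [Nat.add_sub_cancel]
    have h1 : (L[m - 1]?.toList).count DyckStep.D ≤ (L[m - 1]?.toList).length :=
      List.count_le_length
    have h2 : (L[m - 1]?.toList).length ≤ 1 := by cases L[m - 1]? <;> simp
    omega
  have hm2 : m ≠ 1 := by
    intro h
    rw [h, show (1 : ℕ) = 0 + 1 from rfl, List.take_add_one, hL0] at hmle
    simp at hmle
  have hprev : (L.take (m - 1)).count DyckStep.D < (L.take (m - 1)).count DyckStep.U := by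
    have := Nat.find_min hex (m := m - 1) (by omega)
    by_contra hcon
    exact this ⟨by omega, by omega⟩
  have heq : (L.take m).count DyckStep.U = (L.take m).count DyckStep.D := by omega
  let Q : DyckWord := ⟨L.take m, heq, fun j => by
    rw [List.take_take]
    rcases lt_or_ge j m with h | h
    · rw [min_eq_left h.le]; exact hmin j h
    · rw [min_eq_right h]; exact heq.ge⟩
  have hmL : m ≤ L.length := Nat.find_min' hex ⟨hLlen, by rw [List.take_length]; omega⟩
  have hQ := Q.two_mul_semilength_eq_length
  have hQlen : Q.toList.length = m := by simp [Q, hmL]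
  refine ⟨Q.semilength, by omega, ?_, ⟨Q, rfl⟩, ?_⟩
  · have h1 : Q.semilength = (L.take m).count DyckStep.D := Q.semilength_eq_count_D
    have h2 : (L.take m).count DyckStep.D ≤ L.count DyckStep.D :=
      (List.take_sublist m L).count_le _
    unfold startX
    omega
  · rw [hQ, hQlen]

/-- The polynomial `Γ'_N = Γ'_{d,i}[u]` of the north step `N` of `D` at position `t`, where
`d = max K` and `i = min K` (`K` is bounded and, for a north step, non-empty). -/
def gammaStep {n : ℕ} (D : DyckPath n) (t : ℕ) : MvPolynomial ℕ ℝ :=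
  shift (startX D t) (gamma (sSup (returns D t)) (sInf (returns D t)))

/-- The polynomial `Γ'_D`, the product of the `Γ'_N` over all north steps `N` of `D`. -/
def gammaPath {n : ℕ} (D : DyckPath n) : MvPolynomial ℕ ℝ :=
  ∏ t ∈ northSteps D, gammaStep D t

end Permutohedron

end

/-!
Forgetting the last coordinate turns `Vol_n` into Lebesgue measure on `ℝⁿ`, up to a factor
`√(n + 1)`. By Rado's theorem the permutohedron of a decreasing sequence `λ` is the set of vectors
majorized by `λ`. Hence its slice by the hyperplane `y₁ = t`, where `λ_{k+2} ≤ t ≤ λ_{k+1}`, is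
again a permutohedron, that of `λ` with the two terms `λ_{k+1}, λ_{k+2}` replaced by the single
term `λ_{k+1} + λ_{k+2} - t`, and by Fubini's theorem the volumes are determined by a slicing
recursion.

On the other hand the decomposition into pyramids over the facets, which are products of two smaller
permutohedra, suggests a recursive formula `blockVol` for the volume. Its derivative is a sum over
the facets, as the heights enter symmetrically, and integrating Euler's identity for homogeneous
functions over the slices shows that `blockVol` satisfies the slicing recursion.

The polynomial `Γ'_{d,i}` is, up to constants, the height of a facet, and the first return
decomposition of Dyck paths translates the pyramid recursion into the sum over Dyck paths. The
polynomial is unique because the nonnegative orthant is Zariski dense.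
-/

noncomputable section

namespace Permutohedron

open Finset MeasureTheory

/-! ### The recursive volume -/

section Recursion

variable {K : Type*} [Field K]

/-- The height at `i` of the graph of `P` above its chord over `[a, b]`. If `P` is the sequence of
partial sums of `λ`, this is, up to normalisation, the distance from the centre of the
permutohedron of `(λ_{a+1}, …, λ_b)` to its facets on which `i - a` coordinates have the largest
possible sum. -/
def chordHeight (P : ℕ → K) (a b i : ℕ) : K :=
  P i - P a - ((i : K) - a) / ((b : K) - a) * (P b - P a)

/-- The sum, over the types `i` of facets of the block `[a, b]`, of the height of the facet times
its volume. Such a facet is a product of permutohedra of the blocks `[a, i]` and `[i, b]`, and `w`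
prescribes the volumes of the blocks. -/
def facetSum (X : ℕ → K) (w : ℕ → ℕ → K) (a b : ℕ) : K :=
  ∑ i ∈ Ioo a b, chordHeight X a b i * w a i * w i b

/-- The volume of the permutohedron of the block `[a, b]` of the sequence with partial sums `P`,
divided by `(b - a)!` and by the covolume of the lattice of integer vectors with coordinate sum
zero. It is defined by the decomposition into pyramids over the facets. -/
def blockVol (P : ℕ → K) (a b : ℕ) : K :=
  if b ≤ a + 1 then 1 else
    ((b : K) - a - 1)⁻¹ *
      ∑ i : Ioo a b, chordHeight P a b i * blockVol P a i * blockVol P i b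
termination_by b - a
decreasing_by
  all_goals
    have := mem_Ioo.1 i.2
    lia

lemma facetSum_eq_zero (X : ℕ → K) (w : ℕ → ℕ → K) {a b : ℕ} (h : b ≤ a + 1) :
    facetSum X w a b = 0 := by
  have hempty : Ioo a b = ∅ := by ext; simp only [mem_Ioo, notMem_empty]; lia
  rw [facetSum, hempty, sum_empty]

lemma blockVol_of_le (P : ℕ → K) {a b : ℕ} (h : b ≤ a + 1) : blockVol P a b = 1 := by
  rw [blockVol, if_pos h]

lemma blockVol_eq_facetSum (P : ℕ → K) {a b : ℕ} (h : a + 1 < b) :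
    blockVol P a b = ((b : K) - a - 1)⁻¹ * facetSum P (blockVol P) a b := by
  rw [blockVol, if_neg h.not_ge,
    sum_coe_sort (Ioo a b) fun i ↦ chordHeight P a b i * blockVol P a i * blockVol P i b, facetSum]

lemma chordHeight_add_right {P P' : ℕ → K} {s : ℕ} {c : K} {a b i : ℕ}
    (ha : P' (a + s) = P a + c) (hb : P' (b + s) = P b + c) (hi : P' (i + s) = P i + c) :
    chordHeight P' (a + s) (b + s) (i + s) = chordHeight P a b i := by
  simp only [chordHeight, ha, hb, hi, Nat.cast_add, add_sub_add_right_eq_sub]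

lemma blockVol_add_right {P P' : ℕ → K} {s : ℕ} {c : K} {a b : ℕ}
    (h : ∀ j, a ≤ j → j ≤ b → P' (j + s) = P j + c) :
    blockVol P' (a + s) (b + s) = blockVol P a b := by
  induction hd : b - a using Nat.strong_induction_on generalizing a b with
  | _ d ih =>
    rcases lt_or_ge (a + 1) b with hlt | hle
    · rw [blockVol_eq_facetSum P hlt, blockVol_eq_facetSum P' (by lia), facetSum, facetSum,
        ← map_add_right_Ioo, sum_map]
      push_cast
      congr 1
      · ring
      refine sum_congr rfl fun i hi ↦ ?_
      rw [mem_Ioo] at hi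
      rw [addRightEmbedding_apply, chordHeight_add_right (h a le_rfl (by lia))
        (h b (by lia) le_rfl) (h i (by lia) (by lia)),
        ih (i - a) (by lia) (fun j h₁ h₂ ↦ h j h₁ (by lia)) rfl,
        ih (b - i) (by lia) (fun j h₁ h₂ ↦ h j (by lia) h₂) rfl]
    · rw [blockVol_of_le _ hle, blockVol_of_le _ (by lia)]

lemma blockVol_congr {P P' : ℕ → K} {a b : ℕ} (h : ∀ j, a ≤ j → j ≤ b → P' j = P j) :
    blockVol P' a b = blockVol P a b :=
  blockVol_add_right (s := 0) (c := 0) fun j h₁ h₂ ↦ by simpa using h j h₁ h₂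

lemma facetSum_add_mul (X Y : ℕ → K) (t : K) (w : ℕ → ℕ → K) (a b : ℕ) :
    facetSum (fun j ↦ X j + t * Y j) w a b = facetSum X w a b + t * facetSum Y w a b := by
  simp only [facetSum, chordHeight, mul_sum, ← sum_add_distrib]
  exact sum_congr rfl fun i _ ↦ by ring

lemma sum_chordHeight_mul_facetSum (X Y : ℕ → K) (w : ℕ → ℕ → K) (a b : ℕ) :
    ∑ i ∈ Ioo a b, chordHeight X a b i * (facetSum Y w a i * w i b + w a i * facetSum Y w i b) =
      ∑ i ∈ Ioo a b, ∑ l ∈ Ioo a i,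
        (chordHeight X a b i * chordHeight Y a i l + chordHeight X a b l * chordHeight Y l b i) *
          (w a l * w l i * w i b) := by
  have hcomm : ∑ i ∈ Ioo a b, ∑ l ∈ Ioo i b,
        chordHeight X a b i * chordHeight Y i b l * (w a i * w i l * w l b) =
      ∑ l ∈ Ioo a b, ∑ i ∈ Ioo a l,
        chordHeight X a b i * chordHeight Y i b l * (w a i * w i l * w l b) :=
    sum_comm' fun i l ↦ by simp only [mem_Ioo]; lia
  simp only [add_mul, sum_add_distrib]
  rw [← hcomm, ← sum_add_distrib]
  refine sum_congr rfl fun i _ ↦ ?_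
  rw [facetSum, facetSum, mul_add, sum_mul, mul_sum, mul_sum, mul_sum]
  congr 1 <;> exact sum_congr rfl fun l _ ↦ by ring

variable [CharZero K]

lemma facetSum_blockVol (P : ℕ → K) {a b : ℕ} (h : a < b) :
    facetSum P (blockVol P) a b = ((b : K) - a - 1) * blockVol P a b := by
  rcases Nat.lt_or_eq_of_le (Nat.succ_le_of_lt h) with hlt | rfl
  · have hne : (b : K) - a - 1 ≠ 0 := by
      rw [sub_sub, sub_ne_zero]
      exact_mod_cast hlt.ne'
    rw [blockVol_eq_facetSum P hlt, mul_inv_cancel_left₀ hne]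
  · rw [facetSum_eq_zero _ _ le_rfl]
    simp

lemma chordHeight_mul_add_symm (X Y : ℕ → K) {a b i l : ℕ} (hal : a < l) (hli : l < i)
    (hib : i < b) :
    chordHeight X a b i * chordHeight Y a i l + chordHeight X a b l * chordHeight Y l b i =
      chordHeight Y a b i * chordHeight X a i l + chordHeight Y a b l * chordHeight X l b i := by
  have hai : (i : K) - a ≠ 0 := sub_ne_zero.2 (mod_cast (hal.trans hli).ne')
  have hlb : (b : K) - l ≠ 0 := sub_ne_zero.2 (mod_cast (hli.trans hib).ne')
  have hab : (b : K) - a ≠ 0 := sub_ne_zero.2 (mod_cast ((hal.trans hli).trans hib).ne')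
  have hleft (Z : ℕ → K) : chordHeight Z a i l =
      chordHeight Z a b l - ((l : K) - a) / (i - a) * chordHeight Z a b i := by
    simp only [chordHeight]; field_simp; ring
  have hright (Z : ℕ → K) : chordHeight Z l b i =
      chordHeight Z a b i - ((b : K) - i) / (b - l) * chordHeight Z a b l := by
    simp only [chordHeight]; field_simp; ring
  rw [hleft, hright, hleft, hright]
  ring

/-- The second derivative of the volume, as a bilinear form in the heights, is symmetric. -/
lemma sum_chordHeight_mul_facetSum_comm (X Y : ℕ → K) (w : ℕ → ℕ → K) (a b : ℕ) :
    ∑ i ∈ Ioo a b, chordHeight X a b i * (facetSum Y w a i * w i b + w a i * facetSum Y w i b) =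
      ∑ i ∈ Ioo a b,
        chordHeight Y a b i * (facetSum X w a i * w i b + w a i * facetSum X w i b) := by
  rw [sum_chordHeight_mul_facetSum, sum_chordHeight_mul_facetSum]
  refine sum_congr rfl fun i hi ↦ sum_congr rfl fun l hl ↦ ?_
  rw [chordHeight_mul_add_symm X Y (mem_Ioo.1 hl).1 (mem_Ioo.1 hl).2 (mem_Ioo.1 hi).2]

lemma sum_chordHeight_mul_facetSum_blockVol (P Q : ℕ → K) (a b : ℕ) :
    ∑ i ∈ Ioo a b, chordHeight P a b i *
        (facetSum Q (blockVol P) a i * blockVol P i b +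
          blockVol P a i * facetSum Q (blockVol P) i b) =
      ((b : K) - a - 2) * facetSum Q (blockVol P) a b := by
  rw [sum_chordHeight_mul_facetSum_comm, facetSum, mul_sum]
  refine sum_congr rfl fun i hi ↦ ?_
  rw [facetSum_blockVol P (mem_Ioo.1 hi).1, facetSum_blockVol P (mem_Ioo.1 hi).2]
  ring

end Recursion

section Derivative

variable {𝕜 : Type*} [NontriviallyNormedField 𝕜] {γ : 𝕜 → ℕ → 𝕜} {Q : ℕ → 𝕜} {t : 𝕜}

lemma hasDerivAt_chordHeight (hγ : ∀ j, HasDerivAt (fun s ↦ γ s j) (Q j) t) (a b i : ℕ) :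
    HasDerivAt (fun s ↦ chordHeight (γ s) a b i) (chordHeight Q a b i) t :=
  ((hγ i).sub (hγ a)).sub (((hγ b).sub (hγ a)).const_mul _)

lemma hasDerivAt_facetSum (hγ : ∀ j, HasDerivAt (fun s ↦ γ s j) (Q j) t)
    {w : 𝕜 → ℕ → ℕ → 𝕜} {w' : ℕ → ℕ → 𝕜} {a b : ℕ}
    (hl : ∀ i ∈ Ioo a b, HasDerivAt (fun s ↦ w s a i) (w' a i) t)
    (hr : ∀ i ∈ Ioo a b, HasDerivAt (fun s ↦ w s i b) (w' i b) t) :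
    HasDerivAt (fun s ↦ facetSum (γ s) (w s) a b)
      (facetSum Q (w t) a b +
        ∑ i ∈ Ioo a b, chordHeight (γ t) a b i * (w' a i * w t i b + w t a i * w' i b)) t := by
  refine (HasDerivAt.fun_sum fun i hi ↦
    ((hasDerivAt_chordHeight hγ a b i).mul (hl i hi)).mul (hr i hi)).congr_deriv ?_
  rw [facetSum, ← sum_add_distrib]
  exact sum_congr rfl fun i _ ↦ by simp only [Pi.mul_apply]; ring

lemma hasDerivAt_blockVol [CharZero 𝕜] (hγ : ∀ j, HasDerivAt (fun s ↦ γ s j) (Q j) t) {a b : ℕ}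
    (hab : a < b) :
    HasDerivAt (fun s ↦ blockVol (γ s) a b) (facetSum Q (blockVol (γ t)) a b) t := by
  induction hd : b - a using Nat.strong_induction_on generalizing a b with
  | _ d ih =>
    rcases lt_or_ge (a + 1) b with hlt | hle
    · have hne : (b : 𝕜) - a - 1 ≠ 0 := by
        rw [sub_sub, sub_ne_zero]
        exact_mod_cast hlt.ne'
      have hsum := hasDerivAt_facetSum hγ
        (w := fun s ↦ blockVol (γ s)) (w' := facetSum Q (blockVol (γ t)))
        (fun i hi ↦ ih (i - a) (by rw [mem_Ioo] at hi; lia) (mem_Ioo.1 hi).1 rfl)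
        (fun i hi ↦ ih (b - i) (by rw [mem_Ioo] at hi; lia) (mem_Ioo.1 hi).2 rfl)
      simp only [blockVol_eq_facetSum _ hlt]
      refine (hsum.const_mul _).congr_deriv ?_
      rw [sum_chordHeight_mul_facetSum_blockVol, inv_mul_eq_iff_eq_mul₀ hne]
      ring
    · simp only [blockVol_of_le _ hle, facetSum_eq_zero _ _ hle]
      exact hasDerivAt_const t 1

end Derivative

section Slice

/-- The partial sums of the sequence obtained from the differences `λ_{j+1} = P (j + 1) - P j` by
replacing the two terms `λ_{k+1}, λ_{k+2}` by `λ_{k+1} + λ_{k+2} - t`. For `λ` decreasing and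
`λ_{k+2} ≤ t ≤ λ_{k+1}`, the permutohedron of this sequence is the slice of the permutohedron of
`λ` by the hyperplane on which the first coordinate is `t`. -/
def slice {R : Type*} [Sub R] (k : ℕ) (t : R) (P : ℕ → R) : ℕ → R :=
  fun j ↦ if j ≤ k then P j else P (j + 1) - t

lemma slice_of_le {R : Type*} [Sub R] {j k : ℕ} (h : j ≤ k) (t : R) (P : ℕ → R) :
    slice k t P j = P j :=
  if_pos h

lemma slice_of_lt {R : Type*} [Sub R] {j k : ℕ} (h : k < j) (t : R) (P : ℕ → R) :
    slice k t P j = P (j + 1) - t :=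
  if_neg h.not_ge

lemma slice_eq_add_mul {R : Type*} [Ring R] (k : ℕ) (t : R) (P : ℕ → R) :
    slice k t P = fun j ↦ slice k 0 P j + t * if j ≤ k then 0 else -1 := by
  ext j
  simp only [slice]
  split_ifs <;> simp [sub_eq_add_neg]

lemma slice_succ {R : Type*} [AddCommGroup R] (k : ℕ) (P : ℕ → R) :
    slice (k + 1) (P (k + 2) - P (k + 1)) P = slice k (P (k + 2) - P (k + 1)) P := by
  ext j
  obtain h | rfl | h := lt_trichotomy j (k + 1)
  · rw [slice_of_le h.le, slice_of_le (Nat.lt_succ_iff.1 h)]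
  · rw [slice_of_le le_rfl, slice_of_lt k.lt_succ_self]
    abel
  · rw [slice_of_lt h, slice_of_lt (by lia)]

section Field

variable {K : Type*} [Field K] {k a b : ℕ}

lemma blockVol_slice_of_le (hb : b ≤ k) (t : K) (P : ℕ → K) :
    blockVol (slice k t P) a b = blockVol P a b :=
  blockVol_congr fun _ _ h ↦ slice_of_le (h.trans hb) t P

lemma blockVol_slice_of_lt (ha : k < a) (t : K) (P : ℕ → K) :
    blockVol (slice k t P) a b = blockVol P (a + 1) (b + 1) :=
  (blockVol_add_right (c := t) fun j h _ ↦ by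
    rw [slice_of_lt (ha.trans_le h), sub_add_cancel]).symm

lemma blockVol_slice_self (P : ℕ → K) :
    blockVol (slice k (P (k + 1) - P k) P) k b = blockVol P (k + 1) (b + 1) :=
  (blockVol_add_right (c := P (k + 1) - P k) fun j h _ ↦ by
    obtain rfl | h := h.eq_or_lt
    · rw [slice_of_le le_rfl, add_sub_cancel]
    · rw [slice_of_lt h, sub_add_cancel]).symm

lemma sum_chordHeight_slice_mul [CharZero K] (P w : ℕ → K) {c : ℕ} (hac : a < c) :
    (P (a + 1) - P a) * w (a + 1) - (P (c + 1) - P c) * w c +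
        ∑ i ∈ Ioo a c, (((c : K) + 1 - i) * chordHeight (slice i 0 P) a c i * w i +
          ((i : K) + 1 - a) * chordHeight (slice a 0 P) a c i * w (i + 1)) =
      ((c : K) + 1 - a) * ∑ j ∈ Ioo a (c + 1), chordHeight P a (c + 1) j * w j := by
  have hne : (c : K) - a ≠ 0 := sub_ne_zero.2 (mod_cast hac.ne')
  have hne' : (c : K) + 1 - a ≠ 0 := sub_ne_zero.2 (mod_cast (hac.trans c.lt_succ_self).ne')
  set f : ℕ → K := fun i ↦
    ((c : K) + 1 - i) * (P i - P a - ((i : K) - a) / (c - a) * (P (c + 1) - P a)) * w i with hf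
  set g : ℕ → K := fun i ↦ ((i : K) + 1 - a) *
    (P (i + 1) - P a - ((i : K) - a) / (c - a) * (P (c + 1) - P a)) * w (i + 1) with hg
  have hterm : ∀ i ∈ Ioo a c, ((c : K) + 1 - i) * chordHeight (slice i 0 P) a c i * w i +
      ((i : K) + 1 - a) * chordHeight (slice a 0 P) a c i * w (i + 1) = f i + g i := by
    intro i hi
    obtain ⟨hai, hic⟩ := mem_Ioo.1 hi
    simp only [chordHeight, slice_of_le le_rfl, slice_of_le hai.le, slice_of_lt hai,
      slice_of_lt hic, slice_of_lt hac, hf, hg, sub_zero]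
  have hf_right : f c = -((P (c + 1) - P c) * w c) := by
    simp only [hf, div_self hne]
    ring
  have hg_left : g a = (P (a + 1) - P a) * w (a + 1) := by
    simp only [hg]
    ring
  rw [sum_congr rfl hterm, sum_add_distrib, ← hg_left, sub_eq_add_neg, ← hf_right]
  have hshift : ∑ i ∈ Ico a c, g i = ∑ j ∈ Ioo a (c + 1), ((j : K) - a) *
      (P j - P a - ((j : K) - 1 - a) / (c - a) * (P (c + 1) - P a)) * w j := by
    rw [← Ico_add_one_left_eq_Ioo, ← sum_Ico_add' _ a c 1]
    refine sum_congr rfl fun i _ ↦ ?_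
    simp only [hg]
    push_cast
    rw [add_sub_cancel_right]
  have hIoc : ∑ i ∈ Ioo a c, f i + f c = ∑ j ∈ Ioo a (c + 1), f j := by
    rw [sum_Ioo_add_eq_sum_Ioc hac, ← Ico_add_one_left_eq_Ioo, Ico_add_one_add_one_eq_Ioc]
  rw [add_comm (g a), add_add_add_comm, add_comm (f c), hIoc, add_comm (g a),
    sum_Ioo_add_eq_sum_Ico hac, hshift, ← sum_add_distrib, mul_sum]
  refine sum_congr rfl fun j _ ↦ ?_
  simp only [hf, chordHeight]
  push_cast
  field_simp
  ring

end Field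

lemma hasDerivAt_slice {𝕜 : Type*} [NontriviallyNormedField 𝕜] (k : ℕ) (P : ℕ → 𝕜) (t : 𝕜)
    (j : ℕ) : HasDerivAt (fun s ↦ slice k s P j) (if j ≤ k then 0 else -1) t := by
  simp only [slice]
  split_ifs
  · exact hasDerivAt_const t (P j)
  · exact (hasDerivAt_id t).const_sub _

lemma continuous_blockVol_slice {𝕜 : Type*} [NontriviallyNormedField 𝕜] [CharZero 𝕜] (k : ℕ)
    (P : ℕ → 𝕜) (a b : ℕ) : Continuous fun t ↦ blockVol (slice k t P) a b := by
  rcases lt_or_ge a b with h | h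
  · exact continuous_iff_continuousAt.2 fun t ↦
      (hasDerivAt_blockVol (hasDerivAt_slice k P t) h).continuousAt
  · simpa only [blockVol_of_le _ (h.trans a.le_succ)] using continuous_const

/-- Euler's identity `facetSum_blockVol` absorbs the derivative of the volume. -/
lemma hasDerivAt_mul_blockVol_slice {𝕜 : Type*} [NontriviallyNormedField 𝕜] [CharZero 𝕜] (k : ℕ)
    (P : ℕ → 𝕜) (t : 𝕜) {a b : ℕ} (hab : a < b) :
    HasDerivAt (fun s ↦ s * blockVol (slice k s P) a b)
      (((b : 𝕜) - a) * blockVol (slice k t P) a b -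
        facetSum (slice k 0 P) (blockVol (slice k t P)) a b) t := by
  refine ((hasDerivAt_id t).mul
    (hasDerivAt_blockVol (hasDerivAt_slice k P t) hab)).congr_deriv ?_
  have heuler := facetSum_blockVol (slice k t P) hab
  nth_rw 1 [slice_eq_add_mul k t P] at heuler
  rw [facetSum_add_mul] at heuler
  simp only [id_eq]
  linear_combination heuler

/-- The integral of the recursive volume over the `k`-th family of slices. -/
def sliceIntegral (P : ℕ → ℝ) (k a b : ℕ) : ℝ :=
  ∫ t in (P (k + 2) - P (k + 1))..(P (k + 1) - P k), blockVol (slice k t P) a b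

lemma mul_sliceIntegral (P : ℕ → ℝ) (k : ℕ) {a c : ℕ} (hac : a < c) :
    ((c : ℝ) - a) * sliceIntegral P k a c =
      (P (k + 1) - P k) * blockVol (slice k (P (k + 1) - P k) P) a c -
        (P (k + 2) - P (k + 1)) * blockVol (slice k (P (k + 2) - P (k + 1)) P) a c +
      ∑ i ∈ Ioo a c, chordHeight (slice k 0 P) a c i *
        ∫ t in (P (k + 2) - P (k + 1))..(P (k + 1) - P k),
          blockVol (slice k t P) a i * blockVol (slice k t P) i c := by
  have hcont := continuous_blockVol_slice k P
  have hvol : Continuous fun t ↦ ((c : ℝ) - a) * blockVol (slice k t P) a c :=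
    continuous_const.mul (hcont a c)
  have hterm (i : ℕ) : Continuous fun t ↦ chordHeight (slice k 0 P) a c i *
      (blockVol (slice k t P) a i * blockVol (slice k t P) i c) :=
    continuous_const.mul ((hcont a i).mul (hcont i c))
  have hfacet : Continuous fun t ↦ facetSum (slice k 0 P) (blockVol (slice k t P)) a c := by
    simp only [facetSum, mul_assoc]
    exact continuous_finsetSum _ fun i _ ↦ hterm i
  have hftc := intervalIntegral.integral_eq_sub_of_hasDerivAt
    (a := P (k + 2) - P (k + 1)) (b := P (k + 1) - P k)
    (fun t _ ↦ hasDerivAt_mul_blockVol_slice k P t hac) ((hvol.sub hfacet).intervalIntegrable _ _)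
  rw [intervalIntegral.integral_sub (hvol.intervalIntegrable _ _)
    (hfacet.intervalIntegrable _ _), intervalIntegral.integral_const_mul] at hftc
  simp only [facetSum, mul_assoc] at hftc
  rw [intervalIntegral.integral_finsetSum fun i _ ↦ (hterm i).intervalIntegrable _ _] at hftc
  simp only [intervalIntegral.integral_const_mul] at hftc
  rw [← hftc, sliceIntegral, sub_add_cancel]

lemma integral_blockVol_slice_mul_of_le (P : ℕ → ℝ) {a c i k : ℕ} (hik : i ≤ k) :
    ∫ t in (P (k + 2) - P (k + 1))..(P (k + 1) - P k),
        blockVol (slice k t P) a i * blockVol (slice k t P) i c =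
      blockVol P a i * sliceIntegral P k i c := by
  simp only [blockVol_slice_of_le hik, intervalIntegral.integral_const_mul, sliceIntegral]

lemma integral_blockVol_slice_mul_of_lt (P : ℕ → ℝ) {a c i k : ℕ} (hki : k < i) :
    ∫ t in (P (k + 2) - P (k + 1))..(P (k + 1) - P k),
        blockVol (slice k t P) a i * blockVol (slice k t P) i c =
      sliceIntegral P k a i * blockVol P (i + 1) (c + 1) := by
  simp only [blockVol_slice_of_lt hki, intervalIntegral.integral_mul_const, sliceIntegral]

lemma sum_boundary_sliceIntegral (P : ℕ → ℝ) {a c : ℕ} (hac : a ≤ c) :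
    ∑ k ∈ Ico a c, ((P (k + 1) - P k) * blockVol (slice k (P (k + 1) - P k) P) a c -
        (P (k + 2) - P (k + 1)) * blockVol (slice k (P (k + 2) - P (k + 1)) P) a c) =
      (P (a + 1) - P a) * blockVol P (a + 1) (c + 1) - (P (c + 1) - P c) * blockVol P a c := by
  have htelescope := sum_Ico_sub
    (fun k ↦ (P (k + 1) - P k) * blockVol (slice k (P (k + 1) - P k) P) a c) hac
  simp only [slice_succ] at htelescope
  rw [← neg_sub, blockVol_slice_self, blockVol_slice_of_le le_rfl] at htelescope
  rw [← neg_inj, ← htelescope, ← sum_neg_distrib]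
  exact sum_congr rfl fun k _ ↦ neg_sub _ _

lemma mul_sum_sliceIntegral (P : ℕ → ℝ) {a c : ℕ} (hac : a < c) :
    ((c : ℝ) - a) * ∑ k ∈ Ico a c, sliceIntegral P k a c =
      (P (a + 1) - P a) * blockVol P (a + 1) (c + 1) - (P (c + 1) - P c) * blockVol P a c +
      ∑ i ∈ Ioo a c,
        (chordHeight (slice i 0 P) a c i * blockVol P a i * ∑ k ∈ Ico i c, sliceIntegral P k i c +
        chordHeight (slice a 0 P) a c i * (∑ k ∈ Ico a i, sliceIntegral P k a i) *
          blockVol P (i + 1) (c + 1)) := by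
  rw [mul_sum, sum_congr rfl fun k _ ↦ mul_sliceIntegral P k hac, sum_add_distrib,
    sum_boundary_sliceIntegral P hac.le, sum_comm]
  congr 1
  refine sum_congr rfl fun i hi ↦ ?_
  obtain ⟨hai, hic⟩ := mem_Ioo.1 hi
  rw [← sum_Ico_consecutive _ hai.le hic.le, add_comm, mul_sum, mul_sum, sum_mul]
  congr 1 <;> refine sum_congr rfl fun k hk ↦ ?_
  · have hik := (mem_Ico.1 hk).1
    have hkc := (mem_Ico.1 hk).2
    rw [integral_blockVol_slice_mul_of_le P hik, chordHeight, chordHeight,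
      slice_of_le hik, slice_of_le le_rfl, slice_of_le (hai.le.trans hik), slice_of_le hai.le,
      slice_of_lt hkc, slice_of_lt hic]
    ring
  · have hak := (mem_Ico.1 hk).1
    have hki := (mem_Ico.1 hk).2
    rw [integral_blockVol_slice_mul_of_lt P hki, chordHeight, chordHeight,
      slice_of_lt hki, slice_of_lt hai, slice_of_le hak, slice_of_le le_rfl,
      slice_of_lt (hki.trans hic), slice_of_lt hac]
    ring

theorem sum_sliceIntegral (P : ℕ → ℝ) {a c : ℕ} (hac : a < c) :
    ∑ k ∈ Ico a c, sliceIntegral P k a c = ((c : ℝ) + 1 - a) * blockVol P a (c + 1) := by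
  induction hd : c - a using Nat.strong_induction_on generalizing a c with
  | _ d ih =>
    have hne : (c : ℝ) - a ≠ 0 := sub_ne_zero.2 (mod_cast hac.ne')
    refine mul_left_cancel₀ hne ?_
    have hweighted :=
      sum_chordHeight_slice_mul P (fun j ↦ blockVol P a j * blockVol P j (c + 1)) hac
    have hfacet : facetSum P (blockVol P) a (c + 1) = ((c : ℝ) - a) * blockVol P a (c + 1) := by
      rw [facetSum_blockVol P (hac.trans c.lt_succ_self)]
      push_cast
      ring
    simp only [blockVol_of_le P le_rfl, one_mul, mul_one, ← mul_assoc] at hweighted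
    rw [← facetSum, hfacet] at hweighted
    rw [mul_sum_sliceIntegral P hac, mul_left_comm, ← hweighted]
    congr 1
    refine sum_congr rfl fun i hi ↦ ?_
    obtain ⟨hai, hic⟩ := mem_Ioo.1 hi
    rw [ih (c - i) (by lia) hic rfl, ih (i - a) (by lia) hai rfl]
    ring

end Slice

/-! ### The first return decomposition -/

section DyckPath

/-- The semilengths of the nonempty Dyck words that are prefixes of a list of steps. For the steps
of a Dyck path from a north step on, this is the set `K` of `returns`. -/
def prefixSemilengths (L : List DyckStep) : Set ℕ :=
  {k | 1 ≤ k ∧ ∃ Q : DyckWord, Q.semilength = k ∧ Q.toList <+: L}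

lemma returns_eq_prefixSemilengths {n : ℕ} (D : DyckPath n) (t : ℕ) :
    returns D t = prefixSemilengths (D.1.toList.drop t) := by
  ext k
  constructor
  · rintro ⟨hk, -, Q, hQ⟩
    exact ⟨hk, Q.1, Q.2, hQ ▸ List.take_prefix _ _⟩
  · rintro ⟨hk, Q, rfl, hpre⟩
    refine ⟨hk, ?_, ⟨Q, rfl⟩, ?_⟩
    · have hle := hpre.sublist.count_le DyckStep.D
      have hcount := congrArg (List.count DyckStep.D) (List.take_append_drop t D.1.toList)
      rw [List.count_append] at hcount
      rw [← DyckWord.semilength_eq_count_D] at hle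
      rw [← DyckWord.semilength_eq_count_D, D.2] at hcount
      rw [startX]
      lia
    · rw [Q.two_mul_semilength_eq_length]
      exact List.prefix_iff_eq_take.1 hpre

lemma prefixSemilengths_append_D {L : List DyckStep}
    (h : L.count DyckStep.U ≤ L.count DyckStep.D) (L' : List DyckStep) :
    prefixSemilengths (L ++ DyckStep.D :: L') = prefixSemilengths L := by
  ext k
  refine and_congr_right fun _ ↦ exists_congr fun Q ↦ and_congr_right fun _ ↦
    ⟨fun hQ ↦ ?_, fun hQ ↦ hQ.trans (List.prefix_append _ _)⟩
  have hL : L ++ [DyckStep.D] <+: L ++ DyckStep.D :: L' := ⟨L', by simp⟩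
  rcases List.prefix_or_prefix_of_prefix hQ hL with hshort | hlong
  · rcases List.prefix_concat_iff.1 hshort with heq | hpre
    · have hbalanced := Q.count_U_eq_count_D
      rw [heq, List.count_append, List.count_append] at hbalanced
      change _ + 0 = _ + 1 at hbalanced
      lia
    · exact hpre
  · have hnonneg := Q.count_D_le_count_U (L ++ [DyckStep.D]).length
    rw [← List.prefix_iff_eq_take.1 hlong, List.count_append, List.count_append] at hnonneg
    change _ + 1 ≤ _ + 0 at hnonneg
    lia

lemma sSup_prefixSemilengths {A : DyckWord} (hA : A ≠ 0) :
    sSup (prefixSemilengths A.toList) = A.semilength := by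
  have hpos : 1 ≤ A.semilength := by
    have hlen := A.two_mul_semilength_eq_length
    have hlen_pos := List.length_pos_of_ne_nil (DyckWord.toList_ne_nil.2 hA)
    lia
  refine IsGreatest.csSup_eq ⟨⟨hpos, A, rfl, List.prefix_rfl⟩, ?_⟩
  rintro k ⟨-, Q, rfl, hQ⟩
  exact hQ.sublist.count_le _

lemma sInf_prefixSemilengths_nest_add (A B : DyckWord) :
    sInf (prefixSemilengths (A.nest + B).toList) = A.semilength + 1 := by
  refine IsLeast.csInf_eq ⟨⟨by lia, A.nest, A.semilength_nest, List.prefix_append _ _⟩, ?_⟩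
  rintro k ⟨hk, Q, rfl, hQ⟩
  have hnest : A.nest.toList <+: (A.nest + B).toList := List.prefix_append _ _
  rcases List.prefix_or_prefix_of_prefix hQ hnest with h | h
  · have hlen := Q.two_mul_semilength_eq_length
    have hlen_nest := A.nest.two_mul_semilength_eq_length
    rw [DyckWord.semilength_nest] at hlen_nest
    by_contra hlt
    have hstrict :=
      (DyckWord.IsNested.nest (p := A)).2 (i := Q.toList.length) (by lia) (by lia)
    rw [← List.prefix_iff_eq_take.1 h, Q.count_U_eq_count_D] at hstrict
    exact lt_irrefl _ hstrict
  · rw [← DyckWord.semilength_nest]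
    exact h.sublist.count_le _

lemma count_U_le_count_D_of_suffix (A : DyckWord) {L : List DyckStep} (h : L <:+ A.toList) :
    L.count DyckStep.U ≤ L.count DyckStep.D := by
  obtain ⟨L', hL'⟩ := h
  have hprefix := A.count_D_le_count_U L'.length
  have htotal := A.count_U_eq_count_D
  rw [← hL', List.take_left' rfl] at hprefix
  rw [← hL', List.count_append, List.count_append] at htotal
  lia

/-- The product of the polynomials `Γ'_N` over the north steps `N` of a list of steps that starts
at first coordinate `u`. Unlike `gammaPath` it is defined by recursion on the list. -/
def listGamma : ℕ → List DyckStep → MvPolynomial ℕ ℝ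
  | _, [] => 1
  | u, .U :: L =>
    shift u (gamma (sSup (prefixSemilengths (.U :: L))) (sInf (prefixSemilengths (.U :: L)))) *
      listGamma u L
  | u, .D :: L => listGamma (u + 1) L

lemma listGamma_eq_prod (u : ℕ) (L : List DyckStep) :
    listGamma u L = ∏ t ∈ (range L.length).filter fun t ↦ L[t]? = some DyckStep.U,
      shift (u + (L.take t).count DyckStep.D)
        (gamma (sSup (prefixSemilengths (L.drop t))) (sInf (prefixSemilengths (L.drop t)))) := by
  induction L generalizing u with
  | nil => simp [listGamma]
  | cons s L ih =>
    rw [prod_filter, List.length_cons, prod_range_succ']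
    cases s with
    | U =>
      rw [listGamma, ih, prod_filter, mul_comm]
      simp
    | D =>
      rw [listGamma, ih, prod_filter]
      simp [add_assoc, add_comm 1]

lemma gammaPath_eq_listGamma {n : ℕ} (D : DyckPath n) :
    gammaPath D = listGamma 0 D.1.toList := by
  rw [listGamma_eq_prod]
  refine prod_congr rfl fun t _ ↦ ?_
  rw [gammaStep, returns_eq_prefixSemilengths, startX, zero_add]

lemma shift_zero (p : MvPolynomial ℕ ℝ) : shift 0 p = p :=
  MvPolynomial.rename_id_apply p

lemma shift_shift (u v : ℕ) (p : MvPolynomial ℕ ℝ) : shift u (shift v p) = shift (u + v) p := by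
  simp only [shift, MvPolynomial.rename_rename]
  congr 2
  ext j
  simp only [Function.comp]
  lia

lemma listGamma_add (u v : ℕ) (L : List DyckStep) :
    listGamma (u + v) L = shift u (listGamma v L) := by
  induction L generalizing v with
  | nil => simp [listGamma, shift]
  | cons s L ih =>
    cases s with
    | U =>
      rw [listGamma, listGamma, ih, ← shift_shift]
      simp [shift]
    | D => rw [listGamma, listGamma, add_assoc, ih]

lemma listGamma_append_D {L : List DyckStep}
    (h : ∀ L₁, L₁ <:+ L → L₁.count DyckStep.U ≤ L₁.count DyckStep.D) (u : ℕ)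
    (L' : List DyckStep) :
    listGamma u (L ++ DyckStep.D :: L') =
      listGamma u L * listGamma (u + L.count DyckStep.D + 1) L' := by
  induction L generalizing u with
  | nil => simp [listGamma]
  | cons s L ih =>
    have ih' := ih fun L₁ hL ↦ h L₁ (hL.trans (List.suffix_cons s L))
    cases s with
    | U =>
      have hprefix := prefixSemilengths_append_D (h _ List.suffix_rfl) L'
      rw [List.cons_append] at hprefix
      rw [List.cons_append, listGamma, listGamma, ih', hprefix, mul_assoc]
      simp
    | D =>
      rw [List.cons_append, listGamma, listGamma, ih', List.count_cons_self]
      congr 2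
      lia

lemma listGamma_nest_add (A B : DyckWord) :
    listGamma 0 (A.nest + B).toList =
      gamma (A.semilength + B.semilength + 1) (A.semilength + 1) * listGamma 0 A.toList *
        shift (A.semilength + 1) (listGamma 0 B.toList) := by
  have hcons : (A.nest + B).toList = DyckStep.U :: (A.toList ++ DyckStep.D :: B.toList) := by
    change ([DyckStep.U] ++ A.toList ++ [DyckStep.D]) ++ B.toList = _
    simp
  have hne : A.nest + B ≠ 0 := by
    rw [← DyckWord.toList_ne_nil, hcons]
    simp
  have hsup := sSup_prefixSemilengths hne
  have hinf := sInf_prefixSemilengths_nest_add A B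
  rw [hcons] at hsup hinf
  rw [hcons, listGamma, hsup, hinf, shift_zero,
    listGamma_append_D (fun _ ↦ count_U_le_count_D_of_suffix A), ← mul_assoc,
    ← DyckWord.semilength_eq_count_D, ← listGamma_add, DyckWord.semilength_add,
    DyckWord.semilength_nest, add_right_comm A.semilength, zero_add, add_zero]

/-- The first return decomposition: the Dyck path `U A D B` built from the Dyck paths `A`, `B`. -/
def nestAdd {n : ℕ} (s : Σ p : antidiagonal n, DyckPath p.1.1 × DyckPath p.1.2) :
    DyckPath (n + 1) :=
  ⟨s.2.1.1.nest + s.2.2.1, by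
    have hp := HasAntidiagonal.mem_antidiagonal.1 s.1.2
    rw [DyckWord.semilength_add, DyckWord.semilength_nest, s.2.1.2, s.2.2.2]
    lia⟩

lemma nestAdd_injective (n : ℕ) : Function.Injective (nestAdd (n := n)) := by
  rintro ⟨⟨⟨i, j⟩, hp⟩, ⟨A, hA⟩, ⟨B, hB⟩⟩ ⟨⟨⟨i', j'⟩, hp'⟩, ⟨A', hA'⟩, ⟨B', hB'⟩⟩ h
  have hword : A.nest + B = A'.nest + B' := congrArg Subtype.val h
  have hin := congrArg DyckWord.insidePart hword
  have hout := congrArg DyckWord.outsidePart hword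
  simp only [DyckWord.insidePart_add DyckWord.nest_ne_zero, DyckWord.insidePart_nest,
    DyckWord.outsidePart_add DyckWord.nest_ne_zero, DyckWord.outsidePart_nest, zero_add]
    at hin hout
  subst hin hout
  obtain rfl : i = i' := hA.symm.trans hA'
  obtain rfl : j = j' := hB.symm.trans hB'
  rfl

lemma nestAdd_surjective (n : ℕ) : Function.Surjective (nestAdd (n := n)) := by
  rintro ⟨D, hD⟩
  have hne : D ≠ 0 := by
    rintro rfl
    simp at hD
  have hsum := DyckWord.semilength_insidePart_add_semilength_outsidePart_add_one hne
  have hp : (D.insidePart.semilength, D.outsidePart.semilength) ∈ antidiagonal n := by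
    rw [HasAntidiagonal.mem_antidiagonal]
    lia
  exact ⟨⟨⟨_, hp⟩, ⟨D.insidePart, rfl⟩, ⟨D.outsidePart, rfl⟩⟩,
    Subtype.ext (DyckWord.nest_insidePart_add_outsidePart hne)⟩

/-- The right-hand side of the formula for the volume polynomial. -/
def dyckSum (n : ℕ) : MvPolynomial ℕ ℝ :=
  ∑ D : DyckPath n, gammaPath D

lemma dyckSum_zero : dyckSum 0 = 1 := by
  have hnil (D : DyckPath 0) : D.1.toList = [] := by
    have hlen := D.1.two_mul_semilength_eq_length
    rw [D.2] at hlen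
    exact List.length_eq_zero_iff.1 hlen.symm
  have : Unique (DyckPath 0) :=
    ⟨⟨⟨0, rfl⟩⟩, fun D ↦ Subtype.ext (DyckWord.toList_eq_nil.1 (hnil D))⟩
  rw [dyckSum, Fintype.sum_unique, gammaPath_eq_listGamma, hnil, listGamma]

theorem dyckSum_succ (n : ℕ) :
    dyckSum (n + 1) = ∑ p ∈ antidiagonal n,
      gamma (n + 1) (p.1 + 1) * dyckSum p.1 * shift (p.1 + 1) (dyckSum p.2) := by
  rw [dyckSum, ← Function.Bijective.sum_comp ⟨nestAdd_injective n, nestAdd_surjective n⟩,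
    Fintype.sum_sigma, ← sum_coe_sort (antidiagonal n)]
  refine sum_congr rfl fun p _ ↦ ?_
  rw [Fintype.sum_prod_type, dyckSum, dyckSum, shift, map_sum,
    mul_sum univ (gammaPath (n := p.1.1)), sum_mul_sum]
  refine sum_congr rfl fun A _ ↦ sum_congr rfl fun B _ ↦ ?_
  rw [gammaPath_eq_listGamma, nestAdd, listGamma_nest_add, A.2, B.2,
    HasAntidiagonal.mem_antidiagonal.1 p.2, gammaPath_eq_listGamma, gammaPath_eq_listGamma, shift]

end DyckPath

section Evaluation

lemma sum_min_mul_secondDiff {R : Type*} [CommRing R] (P : ℕ → R) {i d : ℕ} (h : i ≤ d) :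
    ∑ j ∈ range d, ((min i (j + 1) : ℕ) : R) * (2 * P (j + 1) - P j - P (j + 2)) =
      i * (P d - P (d + 1)) + P i - P 0 := by
  induction d, h using Nat.le_induction with
  | base =>
    rw [sum_congr rfl fun j hj ↦ by rw [Nat.min_eq_right (by rw [mem_range] at hj; lia)]]
    induction i with
    | zero => simp
    | succ i ih => rw [sum_range_succ, ih]; push_cast; ring
  | succ d hd ih =>
    rw [sum_range_succ, ih, Nat.min_eq_left (by lia)]
    ring

lemma sum_cartanInv_mul_secondDiff (P : ℕ → ℝ) {i d : ℕ} (h : i ≤ d) :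
    ∑ j ∈ range d, cartanInv d i (j + 1) * (2 * P (j + 1) - P j - P (j + 2)) =
      chordHeight P 0 (d + 1) i := by
  have hterm (j : ℕ) (hj : j ∈ range d) :
      cartanInv d i (j + 1) * (2 * P (j + 1) - P j - P (j + 2)) =
        ((min i (j + 1) : ℕ) : ℝ) * (2 * P (j + 1) - P j - P (j + 2)) - (i : ℝ) / (d + 1) *
          (((min d (j + 1) : ℕ) : ℝ) * (2 * P (j + 1) - P j - P (j + 2))) := by
    rw [cartanInv, Nat.min_eq_right (show j + 1 ≤ d from mem_range.1 hj)]
    push_cast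
    ring
  rw [sum_congr rfl hterm, sum_sub_distrib, ← mul_sum, sum_min_mul_secondDiff P h,
    sum_min_mul_secondDiff P le_rfl, chordHeight]
  have hd : (d : ℝ) + 1 ≠ 0 := by positivity
  push_cast
  field_simp
  ring

lemma eval_shift (x : ℕ → ℝ) (u : ℕ) (p : MvPolynomial ℕ ℝ) :
    MvPolynomial.eval x (shift u p) = MvPolynomial.eval (fun j ↦ x (j + u)) p := by
  rw [shift, MvPolynomial.eval_rename]
  rfl

/-- The factor `1 / (d √c_{d,i,i}) * binom(d+1, i)` of `Γ'_{d,i}`. -/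
def gammaCoeff (d i : ℕ) : ℝ :=
  1 / (d * √(cartanInv d i i)) * ((d + 1).choose i : ℝ)

lemma eval_gamma {x P : ℕ → ℝ} {a d i : ℕ} (hi : i ≤ d)
    (hx : ∀ j < d, x j = 2 * P (a + j + 1) - P (a + j) - P (a + j + 2)) :
    MvPolynomial.eval x (gamma d i) =
      gammaCoeff d i * chordHeight P a (a + d + 1) (a + i) := by
  have hheight := chordHeight_add_right (P := fun j ↦ P (a + j)) (P' := P) (s := a) (c := 0)
    (a := 0) (b := d + 1) (i := i) (by simp) (by simp [add_comm a]) (by simp [add_comm a])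
  rw [zero_add, add_comm (d + 1), add_comm i, ← add_assoc] at hheight
  simp only [gamma, map_mul, map_sum, MvPolynomial.eval_C, MvPolynomial.eval_X]
  rw [gammaCoeff, hheight, ← sum_cartanInv_mul_secondDiff _ hi]
  congr 1
  refine sum_congr rfl fun j hj ↦ ?_
  rw [hx j (mem_range.1 hj)]
  rfl

/-- The number `√m m!`, by which `blockVol` of a block of length `m` has to be multiplied to
become the volume of a permutohedron. -/
def volFactor (m : ℕ) : ℝ :=
  √m * m.factorial

lemma gammaCoeff_mul_volFactor {d i k : ℕ} (hi : 0 < i) (hk : 0 < k) (h : i + k = d + 1) :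
    gammaCoeff d i * volFactor i * volFactor k = volFactor (d + 1) * (d : ℝ)⁻¹ := by
  have hchoose := Nat.choose_mul_factorial_mul_factorial (show i ≤ d + 1 by lia)
  rw [show d + 1 - i = k by lia] at hchoose
  have hi' : (0 : ℝ) < i := mod_cast hi
  have hk' : (0 : ℝ) < k := mod_cast hk
  have hd : (d : ℝ) + 1 = i + k := mod_cast h.symm
  have hdiag : cartanInv d i i = (i * k : ℝ) / (d + 1) := by
    rw [cartanInv, min_self, hd]
    field_simp
    ring
  have hpos : (0 : ℝ) < (d : ℝ) + 1 := by positivity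
  have hsqrt_i : √(i : ℝ) ≠ 0 := (Real.sqrt_pos.2 hi').ne'
  have hsqrt_k : √(k : ℝ) ≠ 0 := (Real.sqrt_pos.2 hk').ne'
  have hsqrt_d : √((d : ℝ) + 1) ≠ 0 := (Real.sqrt_pos.2 hpos).ne'
  rw [gammaCoeff, volFactor, volFactor, volFactor, hdiag, Real.sqrt_div (by positivity),
    Real.sqrt_mul hi'.le, ← hchoose]
  push_cast
  rcases eq_or_ne (d : ℝ) 0 with hd0 | hd0
  · simp [hd0]
  · field_simp

theorem eval_dyckSum {x P : ℕ → ℝ} {a m : ℕ}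
    (hx : ∀ j < m, x j = 2 * P (a + j + 1) - P (a + j) - P (a + j + 2)) :
    MvPolynomial.eval x (dyckSum m) = volFactor (m + 1) * blockVol P a (a + m + 1) := by
  induction m using Nat.strong_induction_on generalizing a x with
  | _ m ih =>
    cases m with
    | zero => simp [dyckSum_zero, blockVol_of_le, volFactor]
    | succ n =>
      rw [dyckSum_succ, map_sum, blockVol_eq_facetSum P (by lia), facetSum,
        ← Ico_add_one_left_eq_Ioo, sum_Ico_eq_sum_range, Nat.sum_antidiagonal_eq_sum_range_succ_mk,
        show a + (n + 1) + 1 - (a + 1) = n.succ by lia, mul_sum, mul_sum]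
      refine sum_congr rfl fun i hi ↦ ?_
      have hin : i ≤ n := Nat.lt_succ_iff.1 (mem_range.1 hi)
      have hleft := ih i (by lia) fun j hj ↦ hx j (by lia)
      have hright := ih (n - i) (by lia) (a := a + 1 + i) (x := fun j ↦ x (j + (i + 1)))
        fun j hj ↦ by rw [hx _ (by lia), show a + (j + (i + 1)) = a + 1 + i + j by lia]
      have hcoeff := gammaCoeff_mul_volFactor (d := n + 1) (i := i + 1) (k := n - i + 1)
        (by lia) (by lia) (by lia)
      rw [show a + i + 1 = a + 1 + i by lia] at hleft
      rw [show a + 1 + i + (n - i) + 1 = a + (n + 1) + 1 by lia] at hright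
      rw [map_mul, map_mul, eval_shift, eval_gamma (by lia) hx, hleft, hright,
        show a + (i + 1) = a + 1 + i by lia,
        show ((a + (n + 1) + 1 : ℕ) : ℝ) - a - 1 = ((n + 1 : ℕ) : ℝ) by push_cast; ring]
      linear_combination (chordHeight P a (a + (n + 1) + 1) (a + 1 + i) *
        blockVol P a (a + 1 + i) * blockVol P (a + 1 + i) (a + (n + 1) + 1)) * hcoeff

end Evaluation

/-! ### Majorization -/

/-- Concavity of a sequence of partial sums: the sequence of its differences is decreasing, as are
the coordinates of a dominant weight. -/
def IsConcave {R : Type*} [Sub R] [Preorder R] (P : ℕ → R) : Prop :=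
  Antitone fun k ↦ P (k + 1) - P k

section Concave

variable {K : Type*} [Field K] [LinearOrder K] [IsStrictOrderedRing K] {P : ℕ → K}

lemma IsConcave.slice_eq_min (hP : IsConcave P) {k : ℕ} {t : K}
    (ht : t ∈ Set.Icc (P (k + 2) - P (k + 1)) (P (k + 1) - P k)) (j : ℕ) :
    slice k t P j = min (P j) (P (j + 1) - t) := by
  rcases le_or_gt j k with h | h
  · have hdiff := hP h
    rw [slice_of_le h, min_eq_left (by linarith [ht.2])]
  · have hdiff := hP (Nat.succ_le_of_lt h)
    rw [slice_of_lt h, min_eq_right (by linarith [ht.1])]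

lemma isConcave_slice (hP : IsConcave P) {k : ℕ} {t : K}
    (ht : t ∈ Set.Icc (P (k + 2) - P (k + 1)) (P (k + 1) - P k)) : IsConcave (slice k t P) := by
  refine antitone_nat_of_succ_le fun j ↦ ?_
  rcases lt_trichotomy (j + 1) k with h | rfl | h
  · rw [slice_of_le (by lia), slice_of_le (by lia), slice_of_le (by lia)]
    exact hP j.le_succ
  · have hdiff := hP j.le_succ
    rw [slice_of_lt (by lia), slice_of_le le_rfl, slice_of_le j.le_succ]
    linarith [ht.1]
  · have hdiff := hP (j + 1).le_succ
    rw [slice_of_lt (by lia), slice_of_lt h]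
    rcases Nat.lt_succ_iff.1 h |>.eq_or_lt with rfl | hkj
    · rw [slice_of_le le_rfl]
      linarith [ht.2]
    · rw [slice_of_lt hkj]
      linarith

lemma IsConcave.sum_diff_le (hP : IsConcave P) (S : Finset ℕ) :
    ∑ j ∈ S, (P (j + 1) - P j) ≤ P #S - P 0 := by
  induction S using Finset.induction_on_max with
  | empty => simp
  | insert a S hlt ih =>
    have ha : a ∉ S := fun h ↦ lt_irrefl _ (hlt a h)
    have hcard : #S ≤ a := by simpa using card_le_card fun j hj ↦ mem_range.2 (hlt j hj)
    rw [sum_insert ha, card_insert_of_notMem ha]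
    linarith [hP hcard]

lemma IsConcave.mul_diff_le (hP : IsConcave P) {a i : ℕ} (hai : a ≤ i) :
    ((i : K) - a) * (P (i + 1) - P i) ≤ P i - P a := by
  rw [← sum_Ico_sub P hai, ← Nat.cast_sub hai, ← Nat.card_Ico, ← nsmul_eq_mul]
  exact card_nsmul_le_sum _ _ _ fun j hj ↦ hP (mem_Ico.1 hj).2.le

lemma IsConcave.le_mul_diff (hP : IsConcave P) {i b : ℕ} (hib : i ≤ b) :
    P b - P i ≤ ((b : K) - i) * (P (i + 1) - P i) := by
  rw [← sum_Ico_sub P hib, ← Nat.cast_sub hib, ← Nat.card_Ico, ← nsmul_eq_mul]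
  exact sum_le_card_nsmul _ _ _ fun j hj ↦ hP (mem_Ico.1 hj).1

lemma IsConcave.chordHeight_nonneg (hP : IsConcave P) {a b i : ℕ} (hai : a < i) (hib : i ≤ b) :
    0 ≤ chordHeight P a b i := by
  have hab : (0 : K) < b - a := sub_pos.2 (mod_cast hai.trans_le hib)
  have hai' : (0 : K) ≤ i - a := sub_nonneg.2 (mod_cast hai.le)
  have hib' : (0 : K) ≤ b - i := sub_nonneg.2 (mod_cast hib)
  rw [chordHeight, div_mul_eq_mul_div, sub_nonneg, div_le_iff₀ hab]
  calc ((i : K) - a) * (P b - P a)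
      = (i - a) * (P b - P i) + (i - a) * (P i - P a) := by ring
    _ ≤ (i - a) * ((b - i) * (P (i + 1) - P i)) + (i - a) * (P i - P a) := by
      gcongr
      exact hP.le_mul_diff hib
    _ = (b - i) * ((i - a) * (P (i + 1) - P i)) + (i - a) * (P i - P a) := by ring
    _ ≤ (b - i) * (P i - P a) + (i - a) * (P i - P a) := by
      gcongr
      exact hP.mul_diff_le hai.le
    _ = (P i - P a) * (b - a) := by ring

lemma IsConcave.blockVol_nonneg (hP : IsConcave P) (a b : ℕ) : 0 ≤ blockVol P a b := by
  induction hd : b - a using Nat.strong_induction_on generalizing a b with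
  | _ d ih =>
    rcases lt_or_ge (a + 1) b with hlt | hle
    · have hcast : (a : K) + 1 < b := mod_cast hlt
      rw [blockVol_eq_facetSum P hlt]
      refine mul_nonneg (inv_nonneg.2 (by linarith)) (sum_nonneg fun i hi ↦ ?_)
      obtain ⟨hai, hib⟩ := mem_Ioo.1 hi
      exact mul_nonneg (mul_nonneg (hP.chordHeight_nonneg hai hib.le)
        (ih (i - a) (by lia) a i rfl)) (ih (b - i) (by lia) i b rfl)
    · rw [blockVol_of_le P hle]
      exact zero_le_one

end Concave

lemma exists_between_consecutive {α : Type*} [LinearOrder α] {f : ℕ → α} {n : ℕ} {t : α}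
    (h0 : t ≤ f 0) (hn : f (n + 1) ≤ t) : ∃ k ≤ n, t ∈ Set.Icc (f (k + 1)) (f k) := by
  induction n with
  | zero => exact ⟨0, le_rfl, hn, h0⟩
  | succ n ih =>
    rcases le_total (f (n + 1)) t with h | h
    · obtain ⟨k, hk, ht⟩ := ih h
      exact ⟨k, hk.trans n.le_succ, ht⟩
    · exact ⟨n + 1, le_rfl, hn, h⟩

lemma forall_finset_fin_succ {n : ℕ} {p : Finset (Fin (n + 1)) → Prop} :
    (∀ S, p S) ↔ ∀ T : Finset (Fin n),
      p (T.map (Fin.succEmb n)) ∧ p (insert 0 (T.map (Fin.succEmb n))) := by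
  refine ⟨fun h T ↦ ⟨h _, h _⟩, fun h S ↦ ?_⟩
  obtain ⟨hmap, hinsert⟩ := h (univ.filter fun i ↦ i.succ ∈ S)
  by_cases h0 : 0 ∈ S
  · convert hinsert
    ext i
    cases i using Fin.cases <;> simp [h0, Fin.succ_ne_zero]
  · convert hmap
    ext i
    cases i using Fin.cases <;> simp [h0, Fin.succ_ne_zero]

section Majorization

variable {R : Type*} [AddCommMonoid R] [LE R] {P : ℕ → R} {n : ℕ}

/-- The vectors majorized by the first `n + 1` terms of the decreasing sequence with partial sums
`P`, where `P 0` is meant to be `0`. The bound on the sums over index sets of a given size replaces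
the usual one on the partial sums of the decreasing rearrangement. -/
def majPolytope (n : ℕ) (P : ℕ → R) : Set (Fin (n + 1) → R) :=
  {y | ∑ i, y i = P (n + 1) ∧ ∀ S : Finset (Fin (n + 1)), ∑ i ∈ S, y i ≤ P #S}

lemma cons_mem_majPolytope_iff_forall {t : R} {y : Fin (n + 1) → R} :
    (Fin.cons t y : Fin (n + 2) → R) ∈ majPolytope (n + 1) P ↔
      t + ∑ i, y i = P (n + 2) ∧
        ∀ T : Finset (Fin (n + 1)), ∑ i ∈ T, y i ≤ P #T ∧ t + ∑ i ∈ T, y i ≤ P (#T + 1) := by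
  have hmap (T : Finset (Fin (n + 1))) :
      ∑ i ∈ T.map (Fin.succEmb (n + 1)), (Fin.cons t y : Fin (n + 2) → R) i = ∑ i ∈ T, y i := by
    simp
  have h0 (T : Finset (Fin (n + 1))) : 0 ∉ T.map (Fin.succEmb (n + 1)) := by
    simp [Fin.succ_ne_zero]
  rw [majPolytope, Set.mem_ofPred_eq, forall_finset_fin_succ, Fin.sum_univ_succ]
  simp only [hmap, card_map, sum_insert (h0 _), card_insert_of_notMem (h0 _), Fin.cons_zero,
    Fin.cons_succ]

lemma le_of_mem_majPolytope {y : Fin (n + 1) → R} (h : y ∈ majPolytope n P) (i : Fin (n + 1)) :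
    y i ≤ P 1 := by
  simpa using h.2 {i}

end Majorization

/-- The rearrangements of the first `n + 1` terms of the sequence with partial sums `P`. -/
def rearrangements {R : Type*} [Sub R] (n : ℕ) (P : ℕ → R) : Set (Fin (n + 1) → R) :=
  {y | ∃ σ : Equiv.Perm (Fin (n + 1)), ∀ i, y i = P (σ i + 1) - P (σ i)}

lemma cons_mem_rearrangements {R : Type*} [Sub R] {n : ℕ} (P : ℕ → R) (p : Fin (n + 2))
    (σ : Equiv.Perm (Fin (n + 1))) :
    (Fin.cons (P (p + 1) - P p) fun i ↦ P (p.succAbove (σ i) + 1) - P (p.succAbove (σ i)) :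
      Fin (n + 2) → R) ∈ rearrangements (n + 1) P := by
  have hinj : Function.Injective (Fin.cons p fun i ↦ p.succAbove (σ i) : Fin (n + 2) → _) := by
    rw [Fin.cons_injective_iff]
    exact ⟨by rintro ⟨i, hi⟩; exact Fin.succAbove_ne _ _ hi,
      Fin.succAbove_right_injective.comp σ.injective⟩
  refine ⟨Equiv.ofBijective _ (Finite.injective_iff_bijective.1 hinj), fun i ↦ ?_⟩
  cases i using Fin.cases <;> simp

lemma slice_add_one_sub {R : Type*} [CommRing R] (P : ℕ → R) {n : ℕ} {a b : R} (hab : a + b = 1)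
    {p q : Fin (n + 2)} (hpq : (q : ℕ) = p + 1) (j : Fin (n + 1)) :
    slice p (a * (P (q + 1) - P q) + b * (P (p + 1) - P p)) P (j + 1) -
        slice p (a * (P (q + 1) - P q) + b * (P (p + 1) - P p)) P j =
      a * (P (q.succAbove j + 1) - P (q.succAbove j)) +
        b * (P (p.succAbove j + 1) - P (p.succAbove j)) := by
  obtain rfl : b = 1 - a := eq_sub_of_add_eq' hab
  simp only [Fin.succAbove, Fin.lt_def, Fin.val_castSucc, hpq]
  rcases lt_trichotomy (j : ℕ) p with h | h | h
  · rw [slice_of_le (by lia), slice_of_le h.le, if_pos (by lia), if_pos h]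
    simp only [Fin.val_castSucc]
    ring
  · rw [slice_of_lt (by lia), slice_of_le h.le, if_pos (by lia), if_neg h.not_lt]
    simp only [Fin.val_castSucc, Fin.val_succ, h]
    ring
  · rw [slice_of_lt (by lia), slice_of_lt h, if_neg (by lia), if_neg h.not_gt]
    simp only [Fin.val_succ]
    ring

lemma convex_preimage_cons {R : Type*} [Semiring R] [PartialOrder R] {n : ℕ}
    {s : Set (Fin (n + 1) → R)} (hs : Convex R s) (t : R) :
    Convex R {z : Fin n → R | (Fin.cons t z : Fin (n + 1) → R) ∈ s} := by
  intro z hz w hw a b ha hb hab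
  rw [Set.mem_ofPred_eq]
  convert hs hz hw ha hb hab using 1
  ext i
  cases i using Fin.cases
  · simp [← add_mul, hab]
  · simp

section Rado

variable {K : Type*} [Field K] [LinearOrder K] [IsStrictOrderedRing K] {P : ℕ → K} {n : ℕ}

lemma cons_mem_majPolytope_iff (hP : IsConcave P) {k : ℕ} (hk : k ≤ n) {t : K}
    (ht : t ∈ Set.Icc (P (k + 2) - P (k + 1)) (P (k + 1) - P k)) {y : Fin (n + 1) → K} :
    (Fin.cons t y : Fin (n + 2) → K) ∈ majPolytope (n + 1) P ↔
      y ∈ majPolytope n (slice k t P) := by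
  rw [cons_mem_majPolytope_iff_forall, majPolytope, Set.mem_ofPred_eq,
    slice_of_lt (Nat.lt_succ_of_le hk), eq_sub_iff_add_eq']
  simp only [hP.slice_eq_min ht, le_min_iff, le_sub_iff_add_le']

lemma sub_le_of_mem_majPolytope {y : Fin (n + 1) → K} (h : y ∈ majPolytope n P)
    (i : Fin (n + 1)) : P (n + 1) - P n ≤ y i := by
  have hcompl := h.2 {i}ᶜ
  rw [card_compl, card_singleton, Fintype.card_fin, Nat.add_sub_cancel] at hcompl
  have hsum := sum_compl_add_sum {i} y
  rw [sum_singleton, h.1] at hsum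
  linarith

lemma convex_majPolytope (n : ℕ) (P : ℕ → K) : Convex K (majPolytope n P) := by
  intro y hy z hz a b ha hb hab
  have hsum (S : Finset (Fin (n + 1))) :
      ∑ i ∈ S, (a • y + b • z) i = a * ∑ i ∈ S, y i + b * ∑ i ∈ S, z i := by
    simp [sum_add_distrib, mul_sum]
  refine ⟨?_, fun S ↦ ?_⟩
  · rw [hsum, hy.1, hz.1, ← add_mul, hab, one_mul]
  · calc ∑ i ∈ S, (a • y + b • z) i = a * ∑ i ∈ S, y i + b * ∑ i ∈ S, z i := hsum S
      _ ≤ a * P #S + b * P #S := by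
        gcongr
        exacts [hy.2 S, hz.2 S]
      _ = P #S := by rw [← add_mul, hab, one_mul]

lemma rearrangements_subset_majPolytope (hP : IsConcave P) (h0 : P 0 = 0) :
    rearrangements n P ⊆ majPolytope n P := by
  rintro y ⟨σ, hy⟩
  refine ⟨?_, fun S ↦ ?_⟩
  · simp only [hy]
    rw [Equiv.sum_comp σ fun i : Fin (n + 1) ↦ P (i + 1) - P i,
      Fin.sum_univ_eq_sum_range (fun i ↦ P (i + 1) - P i), sum_range_sub, h0, sub_zero]
  · have hle := hP.sum_diff_le (S.map (σ.toEmbedding.trans Fin.valEmbedding))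
    rw [sum_map, card_map, h0, sub_zero] at hle
    simp only [hy]
    exact hle

/-- Such a vector lies on the segment between two rearrangements, whose first coordinates are the
two consecutive differences of `P` around `t`. -/
lemma cons_mem_convexHull_rearrangements {k : ℕ} (hk : k ≤ n) {t : K}
    (ht : t ∈ Set.Icc (P (k + 2) - P (k + 1)) (P (k + 1) - P k)) {z : Fin (n + 1) → K}
    (hz : z ∈ rearrangements n (slice k t P)) :
    (Fin.cons t z : Fin (n + 2) → K) ∈ convexHull K (rearrangements (n + 1) P) := by
  obtain ⟨σ, hσ⟩ := hz
  rw [← segment_eq_Icc (ht.1.trans ht.2)] at ht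
  obtain ⟨a, b, ha, hb, hab, rfl⟩ := ht
  have hp := cons_mem_rearrangements P (⟨k, by lia⟩ : Fin (n + 2)) σ
  have hq := cons_mem_rearrangements P (⟨k + 1, by lia⟩ : Fin (n + 2)) σ
  convert convex_convexHull K (rearrangements (n + 1) P) (subset_convexHull K _ hq)
    (subset_convexHull K _ hp) ha hb hab using 1
  ext i
  cases i using Fin.cases with
  | zero => simp
  | succ i =>
    simp only [Fin.cons_succ, hσ, Pi.add_apply, Pi.smul_apply, smul_eq_mul]
    exact slice_add_one_sub P hab (p := ⟨k, by lia⟩) (q := ⟨k + 1, by lia⟩) rfl (σ i)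

lemma majPolytope_subset_convexHull (hP : IsConcave P) (h0 : P 0 = 0) :
    majPolytope n P ⊆ convexHull K (rearrangements n P) := by
  induction n generalizing P with
  | zero =>
    intro y hy
    refine subset_convexHull K _ ⟨1, fun i ↦ ?_⟩
    obtain rfl := Fin.fin_one_eq_zero i
    simpa [h0] using hy.1
  | succ n ih =>
    intro y hy
    obtain ⟨t, z, rfl⟩ : ∃ t z, y = Fin.cons t z := ⟨y 0, Fin.tail y, (Fin.cons_self_tail y).symm⟩
    obtain ⟨k, hk, ht⟩ := exists_between_consecutive (f := fun k ↦ P (k + 1) - P k)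
      (by simpa [h0] using le_of_mem_majPolytope hy 0) (sub_le_of_mem_majPolytope hy 0)
    rw [Fin.cons_zero] at ht
    rw [cons_mem_majPolytope_iff hP hk ht] at hy
    exact convexHull_min (fun _ ↦ cons_mem_convexHull_rearrangements hk ht)
      (convex_preimage_cons (convex_convexHull K _) t)
      (ih (isConcave_slice hP ht) (by rw [slice_of_le k.zero_le, h0]) hy)

theorem convexHull_rearrangements (hP : IsConcave P) (h0 : P 0 = 0) :
    convexHull K (rearrangements n P) = majPolytope n P :=
  (convexHull_min (rearrangements_subset_majPolytope hP h0) (convex_majPolytope n P)).antisymm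
    (majPolytope_subset_convexHull hP h0)

end Rado

/-! ### Volumes -/

lemma volume_eq_lintegral_cons {n : ℕ} {S : Set (Fin (n + 1) → ℝ)} (hS : MeasurableSet S) :
    volume S = ∫⁻ t, volume {y : Fin n → ℝ | (Fin.cons t y : Fin (n + 1) → ℝ) ∈ S} := by
  have h := (volume_preserving_piFinSuccAbove (fun _ : Fin (n + 1) ↦ ℝ) 0).symm
  rw [← h.measure_preimage hS.nullMeasurableSet, Measure.volume_eq_prod,
    Measure.prod_apply (h.measurable hS)]
  simp [MeasurableEquiv.piFinSuccAbove_symm_apply, Fin.insertNthEquiv, Set.preimage]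

lemma setLIntegral_Ioc_eq_sum {α : Type*} [MeasurableSpace α] [TopologicalSpace α] [LinearOrder α]
    [OrderClosedTopology α] [OpensMeasurableSpace α] {l : ℕ → α} (hl : Antitone l)
    (μ : Measure α) (f : α → ENNReal) (m : ℕ) :
    ∫⁻ t in Set.Ioc (l m) (l 0), f t ∂μ =
      ∑ k ∈ range m, ∫⁻ t in Set.Ioc (l (k + 1)) (l k), f t ∂μ := by
  induction m with
  | zero => simp
  | succ m ih =>
    rw [sum_range_succ, ← ih, add_comm (∫⁻ t in Set.Ioc (l m) (l 0), f t ∂μ),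
      ← Set.Ioc_union_Ioc_eq_Ioc (hl m.le_succ) (hl m.zero_le),
      lintegral_union measurableSet_Ioc (Set.Ioc_disjoint_Ioc_of_le le_rfl)]

/-- The projection of `majPolytope n P` to `Fin n → ℝ` that forgets the last coordinate, which is
determined by the other ones; its volume is a Lebesgue measure. -/
def projPolytope (n : ℕ) (P : ℕ → ℝ) : Set (Fin n → ℝ) :=
  {y | (Fin.snoc y (P (n + 1) - ∑ i, y i) : Fin (n + 1) → ℝ) ∈ majPolytope n P}

lemma isClosed_majPolytope (n : ℕ) (P : ℕ → ℝ) : IsClosed (majPolytope n P) := by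
  rw [majPolytope, Set.ofPred_and, Set.ofPred_forall]
  exact (isClosed_eq (by fun_prop) continuous_const).inter
    (isClosed_iInter fun S ↦ isClosed_le (by fun_prop) continuous_const)

lemma isClosed_projPolytope (n : ℕ) (P : ℕ → ℝ) : IsClosed (projPolytope n P) :=
  (isClosed_majPolytope n P).preimage
    (Continuous.finSnoc (A := fun _ ↦ ℝ) continuous_id (by fun_prop))

section Slices

variable {n k : ℕ} {P : ℕ → ℝ} {t : ℝ}

lemma cons_mem_projPolytope_iff_snoc {y : Fin n → ℝ} :
    (Fin.cons t y : Fin (n + 1) → ℝ) ∈ projPolytope (n + 1) P ↔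
      (Fin.cons t (Fin.snoc y (P (n + 2) - t - ∑ i, y i) : Fin (n + 1) → ℝ) : Fin (n + 2) → ℝ) ∈
        majPolytope (n + 1) P := by
  rw [projPolytope, Set.mem_ofPred_eq, ← Fin.cons_snoc_eq_snoc_cons, Fin.sum_univ_succ]
  simp only [Fin.cons_zero, Fin.cons_succ, sub_sub]

lemma cons_mem_projPolytope_iff (hP : IsConcave P) (hk : k ≤ n)
    (ht : t ∈ Set.Icc (P (k + 2) - P (k + 1)) (P (k + 1) - P k)) {y : Fin n → ℝ} :
    (Fin.cons t y : Fin (n + 1) → ℝ) ∈ projPolytope (n + 1) P ↔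
      y ∈ projPolytope n (slice k t P) := by
  rw [cons_mem_projPolytope_iff_snoc, cons_mem_majPolytope_iff hP hk ht, projPolytope,
    Set.mem_ofPred_eq, slice_of_lt (Nat.lt_succ_of_le hk)]

lemma mem_Icc_of_cons_mem_projPolytope {y : Fin n → ℝ}
    (h : (Fin.cons t y : Fin (n + 1) → ℝ) ∈ projPolytope (n + 1) P) :
    t ∈ Set.Icc (P (n + 2) - P (n + 1)) (P 1) := by
  rw [cons_mem_projPolytope_iff_snoc] at h
  exact ⟨sub_le_of_mem_majPolytope h 0, le_of_mem_majPolytope h 0⟩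

end Slices

lemma volume_projPolytope_succ {n : ℕ} {P : ℕ → ℝ} (hP : IsConcave P) (h0 : P 0 = 0) :
    volume (projPolytope (n + 1) P) = ∑ k ∈ range (n + 1),
      ∫⁻ t in Set.Ioc (P (k + 2) - P (k + 1)) (P (k + 1) - P k),
        volume (projPolytope n (slice k t P)) := by
  have hsupp : (Function.support fun t ↦ volume {y : Fin n → ℝ |
      (Fin.cons t y : Fin (n + 1) → ℝ) ∈ projPolytope (n + 1) P}) ⊆
      Set.Icc (P (n + 2) - P (n + 1)) (P 1 - P 0) := by
    intro t ht
    obtain ⟨y, hy⟩ := nonempty_of_measure_ne_zero (Function.mem_support.1 ht)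
    rw [h0, sub_zero]
    exact mem_Icc_of_cons_mem_projPolytope hy
  rw [volume_eq_lintegral_cons (isClosed_projPolytope _ _).measurableSet,
    ← setLIntegral_eq_of_support_subset hsupp, ← setLIntegral_congr Ioc_ae_eq_Icc,
    setLIntegral_Ioc_eq_sum (l := fun k ↦ P (k + 1) - P k) hP]
  refine sum_congr rfl fun k hk ↦ setLIntegral_congr_fun measurableSet_Ioc fun t ht ↦ ?_
  refine congrArg volume (Set.ext fun y ↦ ?_)
  exact cons_mem_projPolytope_iff hP (Nat.le_of_lt_succ (mem_range.1 hk))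
    (Set.Ioc_subset_Icc_self ht)

lemma projPolytope_zero {P : ℕ → ℝ} (h0 : P 0 = 0) : projPolytope 0 P = Set.univ := by
  refine Set.eq_univ_of_forall fun y ↦ ⟨?_, fun S ↦ ?_⟩
  · simp [Fin.snoc]
  · obtain rfl | rfl : S = ∅ ∨ S = {0} :=
      subset_singleton_iff.1 fun i _ ↦ mem_singleton.2 (Fin.fin_one_eq_zero i)
    · simp [h0]
    · simp [Fin.snoc]

lemma IsConcave.lintegral_blockVol_slice {P : ℕ → ℝ} (hP : IsConcave P) {c : ℝ} (hc : 0 ≤ c)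
    (k a b : ℕ) :
    ∫⁻ t in Set.Ioc (P (k + 2) - P (k + 1)) (P (k + 1) - P k),
        ENNReal.ofReal (c * blockVol (slice k t P) a b) =
      ENNReal.ofReal (c * sliceIntegral P k a b) := by
  rw [sliceIntegral, intervalIntegral.integral_of_le (hP k.le_succ), ← integral_const_mul,
    ofReal_integral_eq_lintegral_ofReal]
  · exact ((continuous_blockVol_slice k P a b).const_mul c).integrableOn_Ioc
  · refine (ae_restrict_iff' measurableSet_Ioc).2 (.of_forall fun t ht ↦ ?_)
    exact mul_nonneg hc ((isConcave_slice hP (Set.Ioc_subset_Icc_self ht)).blockVol_nonneg a b)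

lemma IsConcave.sliceIntegral_nonneg {P : ℕ → ℝ} (hP : IsConcave P) (k a b : ℕ) :
    0 ≤ sliceIntegral P k a b :=
  intervalIntegral.integral_nonneg (hP k.le_succ) fun _ ht ↦
    (isConcave_slice hP ht).blockVol_nonneg a b

theorem volume_projPolytope {n : ℕ} {P : ℕ → ℝ} (hP : IsConcave P) (h0 : P 0 = 0) :
    volume (projPolytope n P) = ENNReal.ofReal ((n + 1).factorial * blockVol P 0 (n + 1)) := by
  induction n generalizing P with
  | zero => simp [projPolytope_zero h0, blockVol_of_le, volume_pi]
  | succ n ih =>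
    calc volume (projPolytope (n + 1) P)
        = ∑ k ∈ range (n + 1), ∫⁻ t in Set.Ioc (P (k + 2) - P (k + 1)) (P (k + 1) - P k),
            volume (projPolytope n (slice k t P)) := volume_projPolytope_succ hP h0
      _ = ∑ k ∈ range (n + 1),
            ENNReal.ofReal ((n + 1).factorial * sliceIntegral P k 0 (n + 1)) := by
        refine sum_congr rfl fun k _ ↦ ?_
        rw [← hP.lintegral_blockVol_slice (Nat.cast_nonneg _)]
        refine setLIntegral_congr_fun measurableSet_Ioc fun t ht ↦ ?_
        exact ih (isConcave_slice hP (Set.Ioc_subset_Icc_self ht))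
          (by rw [slice_of_le k.zero_le, h0])
      _ = ENNReal.ofReal
            ((n + 1).factorial * ∑ k ∈ Ico 0 (n + 1), sliceIntegral P k 0 (n + 1)) := by
        rw [← ENNReal.ofReal_sum_of_nonneg fun k _ ↦
          mul_nonneg (Nat.cast_nonneg _) (hP.sliceIntegral_nonneg k 0 _), mul_sum,
          Nat.Ico_zero_eq_range]
      _ = ENNReal.ofReal ((n + 2).factorial * blockVol P 0 (n + 2)) := by
        rw [sum_sliceIntegral P n.succ_pos, Nat.factorial_succ (n + 1)]
        push_cast
        congr 1
        ring

/-- The coordinates on `E n` given by all but the last coordinate in `ℝ^(n+1)`. They are compared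
to orthonormal coordinates in `vol_preimage_dropLast`. -/
def dropLast (n : ℕ) : E n ≃ₗ[ℝ] (Fin n → ℝ) where
  toFun w i := w.1 i.castSucc
  map_add' _ _ := rfl
  map_smul' _ _ := rfl
  invFun y := ⟨WithLp.toLp 2 (Fin.snoc y (-∑ i, y i) : Fin (n + 1) → ℝ), by
    change ∑ k, (Fin.snoc y (-∑ i, y i) : Fin (n + 1) → ℝ) k = 0
    simp [Fin.sum_univ_castSucc]⟩
  left_inv w := by
    have hw : ∑ k, w.1 k = 0 := w.2
    rw [Fin.sum_univ_castSucc] at hw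
    ext k
    cases k using Fin.lastCases with
    | last => simp; linarith
    | cast i => simp
  right_inv y := by
    ext i
    simp

lemma det_gram_dropLast_symm (n : ℕ) :
    (Matrix.gram ℝ fun i ↦ (dropLast n).symm (Pi.single i 1)).det = n + 1 := by
  have hgram : Matrix.gram ℝ (fun i ↦ (dropLast n).symm (Pi.single i 1)) =
      (1 : Matrix (Fin n) (Fin n) ℝ) +
        Matrix.replicateCol Unit (fun _ ↦ (1 : ℝ)) * Matrix.replicateRow Unit fun _ ↦ (1 : ℝ) := by
    ext i j
    simp only [Matrix.gram, Matrix.of_apply, Submodule.coe_inner, PiLp.inner_apply,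
      Fin.sum_univ_castSucc]
    simp [dropLast, Matrix.one_apply, Pi.single_apply, Matrix.mul_apply, eq_comm]
  rw [hgram, Matrix.det_one_add_replicateCol_mul_replicateRow]
  simp [dotProduct, add_comm]

lemma vol_preimage_dropLast (n : ℕ) (S : Set (Fin n → ℝ)) :
    vol n (dropLast n ⁻¹' S) = ENNReal.ofReal √(n + 1) * volume S := by
  let e : EuclideanSpace ℝ (Fin n) ≃ₗ[ℝ] E n := (WithLp.linearEquiv 2 ℝ _).trans (dropLast n).symm
  let f : EuclideanSpace ℝ (Fin n) →ₗ[ℝ] E n := e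
  have hdet : f.normDet = √(n + 1) := by
    rw [← Real.sqrt_sq f.normDet_nonneg, ← det_gram_dropLast_symm]
    exact congrArg Real.sqrt <|
      (f.normDet_sq_eq_det_gram (EuclideanSpace.basisFun (Fin n) ℝ)).trans (by simp [f, e])
  have himage : f '' (WithLp.ofLp ⁻¹' S) = dropLast n ⁻¹' S := e.image_eq_preimage_symm _
  rw [vol, OrthonormalBasis.addHaar_eq_volume,
    ← InnerProductSpace.euclideanHausdorffMeasure_eq_volume, ← e.finrank_eq, ← himage,
    f.euclideanHausdorffMeasure_image_eq_normDet_mul_volume, hdet]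
  exact congrArg _ ((EuclideanSpace.volume_preserving_symm_measurableEquiv_toLp
    (Fin n)).measure_preimage_equiv S)

/-! ### The volume polynomial -/

/-- The partial sums of the coordinates of `∑ i, x i • ϖ_{i+1}`. Their second differences are the
numbers `-x i`, so that weights with nonnegative coefficients have concave partial sums. -/
def weightSums (n : ℕ) (x : ℕ → ℝ) (j : ℕ) : ℝ :=
  ∑ i ∈ range n, x i * cartanInv n j (i + 1)

lemma weightSums_zero (n : ℕ) (x : ℕ → ℝ) : weightSums n x 0 = 0 := by
  simp [weightSums, cartanInv]

lemma weightSums_succ_self (n : ℕ) (x : ℕ → ℝ) : weightSums n x (n + 1) = 0 := by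
  refine sum_eq_zero fun i hi ↦ ?_
  rw [cartanInv, min_eq_right (by rw [mem_range] at hi; lia)]
  push_cast
  field_simp
  ring

lemma secondDiff_cartanInv (n i j : ℕ) :
    2 * cartanInv n (j + 1) (i + 1) - cartanInv n j (i + 1) - cartanInv n (j + 2) (i + 1) =
      if i = j then 1 else 0 := by
  simp only [cartanInv]
  rcases lt_trichotomy i j with h | rfl | h
  · rw [if_neg h.ne, min_eq_right (by lia), min_eq_right (by lia), min_eq_right (by lia)]
    push_cast
    ring
  · rw [if_pos rfl, min_self, min_eq_left (by lia), min_eq_right (by lia)]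
    push_cast
    ring
  · rw [if_neg h.ne', min_eq_left (by lia), min_eq_left (by lia), min_eq_left (by lia)]
    push_cast
    ring

lemma secondDiff_weightSums (n : ℕ) (x : ℕ → ℝ) (j : ℕ) :
    2 * weightSums n x (j + 1) - weightSums n x j - weightSums n x (j + 2) =
      if j < n then x j else 0 := by
  calc 2 * weightSums n x (j + 1) - weightSums n x j - weightSums n x (j + 2)
      = ∑ i ∈ range n, x i * (2 * cartanInv n (j + 1) (i + 1) - cartanInv n j (i + 1) -
          cartanInv n (j + 2) (i + 1)) := by
        simp only [weightSums, mul_sum, ← sum_sub_distrib]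
        exact sum_congr rfl fun i _ ↦ by ring
    _ = if j < n then x j else 0 := by simp [secondDiff_cartanInv]

lemma isConcave_weightSums {n : ℕ} {x : ℕ → ℝ} (hx : ∀ j < n, 0 ≤ x j) :
    IsConcave (weightSums n x) := by
  refine antitone_nat_of_succ_le fun j ↦ ?_
  have hdiff := secondDiff_weightSums n x j
  split_ifs at hdiff with hj
  · linarith [hx j hj]
  · linarith

lemma coe_fundamentalWeight_apply (n : ℕ) (i : Fin n) (k : Fin (n + 1)) :
    (fundamentalWeight n i).1 k = cartanInv n (k + 1) (i + 1) - cartanInv n k (i + 1) := by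
  simp only [fundamentalWeight, cartanInv]
  split_ifs with h
  · rw [min_eq_left (by lia), min_eq_left (by lia)]
    push_cast
    ring
  · rw [min_eq_right (by lia), min_eq_right (by lia)]
    push_cast
    ring

lemma coe_sum_fundamentalWeight_apply (n : ℕ) (x : ℕ → ℝ) (k : Fin (n + 1)) :
    (∑ i : Fin n, x i • fundamentalWeight n i).1 k =
      weightSums n x (k + 1) - weightSums n x k := by
  calc (∑ i : Fin n, x i • fundamentalWeight n i).1 k
      = ∑ i : Fin n, x i * (cartanInv n (k + 1) (i + 1) - cartanInv n k (i + 1)) := by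
        simp [← coe_fundamentalWeight_apply]
    _ = weightSums n x (k + 1) - weightSums n x k := by
        rw [Fin.sum_univ_eq_sum_range fun i ↦
          x i * (cartanInv n (k + 1) (i + 1) - cartanInv n k (i + 1))]
        simp only [weightSums, mul_sub, sum_sub_distrib]

/-- The coordinates in `ℝ^(n+1)` of a vector of `E n`, without the Euclidean norm; it transports
convex hulls in `E n` to `Fin (n + 1) → ℝ`. -/
def coords (n : ℕ) : E n →ₗ[ℝ] (Fin (n + 1) → ℝ) :=
  (WithLp.linearEquiv 2 ℝ (Fin (n + 1) → ℝ)).toLinearMap ∘ₗ (E n).subtype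

lemma coords_injective (n : ℕ) : Function.Injective (coords n) :=
  (WithLp.linearEquiv 2 ℝ _).injective.comp (E n).injective_subtype

section Permutohedron

variable {n : ℕ} {P : ℕ → ℝ} {v : E n}

lemma coords_image_weylOrbit (hv : ∀ k : Fin (n + 1), v.1 k = P (k + 1) - P k) :
    coords n '' weylOrbit n v = rearrangements n P := by
  ext y
  constructor
  · rintro ⟨w, ⟨σ, hσ⟩, rfl⟩
    exact ⟨σ, fun i ↦ (hσ i).trans (hv _)⟩
  · rintro ⟨σ, hσ⟩
    have hyv (k : Fin (n + 1)) : y k = v.1 (σ k) := (hσ k).trans (hv _).symm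
    have hy : ∑ k, y k = 0 := by
      simp only [hyv]
      exact (Equiv.sum_comp σ v.1).trans v.2
    exact ⟨⟨WithLp.toLp 2 y, hy⟩, ⟨σ, hyv⟩, rfl⟩

lemma mem_permutohedron_iff (hP : IsConcave P) (h0 : P 0 = 0)
    (hv : ∀ k : Fin (n + 1), v.1 k = P (k + 1) - P k) {w : E n} :
    w ∈ permutohedron n v ↔ coords n w ∈ majPolytope n P := by
  rw [← convexHull_rearrangements hP h0, ← coords_image_weylOrbit hv,
    ← LinearMap.image_convexHull, (coords_injective n).mem_set_image, permutohedron]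

lemma permutohedron_eq_preimage_dropLast (hP : IsConcave P) (h0 : P 0 = 0) (hn : P (n + 1) = 0)
    (hv : ∀ k : Fin (n + 1), v.1 k = P (k + 1) - P k) :
    permutohedron n v = dropLast n ⁻¹' projPolytope n P := by
  ext w
  have hw : coords n w =
      (Fin.snoc (dropLast n w) (0 - ∑ i, dropLast n w i) : Fin (n + 1) → ℝ) := by
    rw [zero_sub]
    exact congrArg (coords n) ((dropLast n).symm_apply_apply w).symm
  rw [mem_permutohedron_iff hP h0 hv, Set.mem_preimage, projPolytope, Set.mem_ofPred_eq, hn, hw]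

theorem vol_permutohedron (hP : IsConcave P) (h0 : P 0 = 0) (hn : P (n + 1) = 0)
    (hv : ∀ k : Fin (n + 1), v.1 k = P (k + 1) - P k) :
    vol n (permutohedron n v) = ENNReal.ofReal (volFactor (n + 1) * blockVol P 0 (n + 1)) := by
  rw [permutohedron_eq_preimage_dropLast hP h0 hn hv, vol_preimage_dropLast,
    volume_projPolytope hP h0, ← ENNReal.ofReal_mul (Real.sqrt_nonneg _), ← mul_assoc, volFactor,
    Nat.cast_add_one]

end Permutohedron

theorem isVolumePolynomial_dyckSum (n : ℕ) : IsVolumePolynomial n (dyckSum n) := by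
  intro x hx
  have hP := isConcave_weightSums hx
  have hnonneg : 0 ≤ volFactor (n + 1) * blockVol (weightSums n x) 0 (n + 1) :=
    mul_nonneg (by unfold volFactor; positivity) (hP.blockVol_nonneg 0 (n + 1))
  have heval : MvPolynomial.eval x (dyckSum n) =
      volFactor (n + 1) * blockVol (weightSums n x) 0 (0 + n + 1) :=
    eval_dyckSum fun j hj ↦ by rw [zero_add, secondDiff_weightSums, if_pos hj]
  rw [vol_permutohedron hP (weightSums_zero n x) (weightSums_succ_self n x)
    (coe_sum_fundamentalWeight_apply n x), ENNReal.toReal_ofReal hnonneg, heval, zero_add]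

lemma IsVolumePolynomial.unique {n : ℕ} {V W : MvPolynomial ℕ ℝ} (hV : IsVolumePolynomial n V)
    (hW : IsVolumePolynomial n W) : V = W := by
  refine MvPolynomial.funext_set (fun _ ↦ Set.Ici (0 : ℝ)) (fun _ ↦ Set.Ici_infinite 0)
    fun x hx ↦ ?_
  have hx' (j : ℕ) (_ : j < n) : 0 ≤ x j := hx j (Set.mem_univ j)
  rw [hV x hx', hW x hx']

end Permutohedron

end

theorem theorem3 (n : ℕ) :
    (∃! V : MvPolynomial ℕ ℝ, Permutohedron.IsVolumePolynomial n V) ∧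
      ∀ V : MvPolynomial ℕ ℝ, Permutohedron.IsVolumePolynomial n V →
        V = ∑ D : Permutohedron.DyckPath n, Permutohedron.gammaPath D := by
  have hsum := Permutohedron.isVolumePolynomial_dyckSum n
  exact ⟨⟨_, hsum, fun _ hV ↦ hV.unique hsum⟩, fun _ hV ↦ hV.unique hsum⟩
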